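/- **Notation.** $\mathcal O_n$, $S\mathcal O_n$, $U_n$ are the orthogonal, special orthogonal and unitary groups, $\mathfrak{so}_n$ the real skew-symmetric $n\times n$ matrices, $E_\varphi=\begin{pmatrix}\cos\varphi&-\sin\varphi\\ \sin\varphi&\cos\varphi\end{pmatrix}$. $A_1\oplus\cdots\oplus A_s$ is the block diagonal matrix with blocks $A_1,\dots,A_s$, $A^{\oplus m}$ is $A\oplus\cdots\oplus A$ ($m$ times), and for sets of square matrices $\mathcal S_1\oplus\cdots\oplus\mathcal S_s=\{B_1\oplus\cdots\oplus B_s: B_j\in\mathcal S_j\}$. $\mathcal C_B$ is the group of non-singular real matrices commuting with $B$, and $\Gamma_C(X)=CXC^T$. $Sym_p(q)$ (resp. $Herm_p(q)$) is the set of non-singular real symmetric (resp. complex Hermitian) $p\times p$ matrices with $q$ positive and $p-q$ negative eigenvalues, counted with multiplicity. A complex $m\times m$ matrix is regarded as a real $2m\times 2m$ matrix by replacing each entry $z$ by the block $\mathrm{Re}(z)I_2+\mathrm{Im}(z)E_{\pi/2}$. **Setting.** Let $h,r,k\ge 0$, $m_1,\dots,m_r\ge 1$, $0<\theta_1<\cdots<\theta_r<\pi$,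 $n=h+2\sum_j m_j+2k$, and $$\mathcal J_M=I_h\oplus E_{\theta_1}^{\oplus m_1}\oplus\cdots\oplus E_{\theta_r}^{\oplus m_r}\oplus(-I_{2k}).$$ Let $M\in S\mathcal O_n$ and $C_0\in\mathcal O_n$ satisfy $M=C_0\mathcal J_MC_0^T$. Let $0\le u\le h$ and $0\le\mu_j\le m_j$ for $1\le j\le r$, and $$\widetilde{\mathcal J}=I_u\oplus(-I_{h-u})\oplus\bigoplus_{j=1}^r\Big(E_{\theta_j/2}^{\oplus\mu_j}\oplus E_{\theta_j/2-\pi}^{\oplus(m_j-\mu_j)}\Big)\oplus E_{\pi/2}^{\oplus k}.$$ For $N\in\{M,\mathcal J_M\}$ let $\mathcal{OSR}(N)_u^{(\mu_1,\dots,\mu_r)}$ be the set of all $Y\in\mathcal O_n$ with $Y^2=N$ whose eigenvalues are $1$ with multiplicity $u$, $-1$ with multiplicity $h-u$, $e^{\pm i\theta_j/2}$ each with multiplicity $\mu_j$ and $e^{\pm i(\theta_j/2-\pi)}$ each with multiplicity $m_j-\mu_j$ ($1\le j\le r$), and $\pm i$ each with multiplicity $k$. **Proposition 4.2.** Then $$\mathcal{OSR}(M)_u^{(\mu_1,\dots,\mu_r)}=\{C_0X\widetilde{\mathcal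 J}X^TC_0^T: X\in\mathcal C_{\mathcal J_M}\cap\mathcal O_n\}=\Gamma_{C_0}\big(\mathcal{OSR}(\mathcal J_M)_u^{(\mu_1,\dots,\mu_r)}\big),$$ and $$\mathcal{OSR}(\mathcal J_M)_u^{(\mu_1,\dots,\mu_r)}=[\mathcal O_h\cap Sym_h(u)]\oplus\Big[\bigoplus_{j=1}^r e^{i\theta_j/2}\big(U_{m_j}\cap Herm_{m_j}(\mu_j)\big)\Big]\oplus[\mathcal O_{2k}\cap\mathfrak{so}_{2k}].$$ Moreover $\mathcal C_{\widetilde{\mathcal J}}\cap\mathcal O_n\subseteq\mathcal C_{\mathcal J_M}\cap\mathcal O_n$, and $\mathcal{OSR}(M)_u^{(\mu_1,\dots,\mu_r)}$ is a compact (embedded) submanifold of $\mathcal O_n$, diffeomorphic to the homogeneous space $\dfrac{\mathcal C_{\mathcal J_M}\cap\mathcal O_n}{\mathcal C_{\widetilde{\mathcal J}}\cap\mathcal O_n}$. -/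

import Mathlib

open Matrix Manifold
open scoped ContDiff Matrix.Norms.L2Operator

noncomputable section

namespace OrthRoots

/-! ### Block matrices -/

/-- The rotation matrix `E_θ`. -/
def rot (θ : ℝ) : Matrix (Fin 2) (Fin 2) ℝ :=
  !![Real.cos θ, -Real.sin θ; Real.sin θ, Real.cos θ]

/-- `E_{φ_0} ⊕ ⋯ ⊕ E_{φ_{m-1}}`; the pair `(a, s)` is row `s` of the `a`-th `2 × 2` block. -/
def rotBlocks {m : ℕ} (φ : Fin m → ℝ) : Matrix (Fin m × Fin 2) (Fin m × Fin 2) ℝ :=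
  Matrix.of fun p q => if p.1 = q.1 then rot (φ p.1) p.2 q.2 else 0

/-- The embedding `ρ_m` of complex `m × m` matrices into real `2m × 2m` matrices: every entry `z` is
replaced by the `2 × 2` block `Re z • I₂ + Im z • E_{π/2}`. -/
def rho {m : ℕ} (Z : Matrix (Fin m) (Fin m) ℂ) : Matrix (Fin m × Fin 2) (Fin m × Fin 2) ℝ :=
  Matrix.of fun p q =>
    !![(Z p.1 q.1).re, -(Z p.1 q.1).im; (Z p.1 q.1).im, (Z p.1 q.1).re] p.2 q.2

/-- Row labels of a matrix with diagonal blocks of orders `h`, `2 m_1, …, 2 m_r`, `2 k`. -/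
abbrev BlockIdx {r : ℕ} (h : ℕ) (m : Fin r → ℕ) (k : ℕ) : Type :=
  Fin h ⊕ ((Σ j : Fin r, Fin (m j) × Fin 2) ⊕ (Fin k × Fin 2))

/-- The row labels listed in their natural order (first block first, lexicographically within each
block). -/
def blockEquiv {n r h k : ℕ} {m : Fin r → ℕ} (hn : h + ((∑ j, m j * 2) + k * 2) = n) :
    BlockIdx h m k ≃ Fin n :=
  ((Equiv.sumCongr (Equiv.refl (Fin h))
    ((Equiv.sumCongr
      ((Equiv.sigmaCongrRight fun _ => finProdFinEquiv).trans finSigmaFinEquiv)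
      finProdFinEquiv).trans finSumFinEquiv)).trans finSumFinEquiv).trans (finCongr hn)

/-- The block diagonal `n × n` matrix `A ⊕ B_1 ⊕ ⋯ ⊕ B_r ⊕ D`. -/
def blockSum {n r h k : ℕ} {m : Fin r → ℕ} (hn : h + ((∑ j, m j * 2) + k * 2) = n)
    (A : Matrix (Fin h) (Fin h) ℝ)
    (B : ∀ j, Matrix (Fin (m j) × Fin 2) (Fin (m j) × Fin 2) ℝ)
    (D : Matrix (Fin k × Fin 2) (Fin k × Fin 2) ℝ) : Matrix (Fin n) (Fin n) ℝ :=
  Matrix.reindex (blockEquiv hn) (blockEquiv hn)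
    (Matrix.fromBlocks A 0 0 (Matrix.fromBlocks (Matrix.blockDiagonal' B) 0 0 D))

/-- The real Jordan standard form
`I_h ⊕ E_{θ_1}^{⊕ m_1} ⊕ ⋯ ⊕ E_{θ_r}^{⊕ m_r} ⊕ (-I_{2k})`. -/
def rjs {n r h k : ℕ} {m : Fin r → ℕ} (hn : h + ((∑ j, m j * 2) + k * 2) = n)
    (θ : Fin r → ℝ) : Matrix (Fin n) (Fin n) ℝ :=
  blockSum hn 1 (fun j => rotBlocks fun _ => θ j) (-1)

/-- The real Jordan auxiliary form
`I_u ⊕ (-I_{h-u}) ⊕ ⨁_j (E_{θ_j/2}^{⊕ μ_j} ⊕ E_{θ_j/2-π}^{⊕ (m_j-μ_j)}) ⊕ E_{π/2}^{⊕ k}`. -/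
def rja {n r h k : ℕ} {m : Fin r → ℕ} (hn : h + ((∑ j, m j * 2) + k * 2) = n)
    (θ : Fin r → ℝ) (u : ℕ) (μ : Fin r → ℕ) : Matrix (Fin n) (Fin n) ℝ :=
  blockSum hn
    (Matrix.diagonal fun i => if i.val < u then 1 else -1)
    (fun j => rotBlocks fun a => if a.val < μ j then θ j / 2 else θ j / 2 - Real.pi)
    (rotBlocks fun _ => Real.pi / 2)

/-! ### Orthogonal square roots and their strata -/

/-- Multiplicity of the complex number `z` as an eigenvalue of the real matrix `Y`. -/
def eigMult {n : ℕ} (Y : Matrix (Fin n) (Fin n) ℝ) (z : ℂ) : ℕ :=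
  (Y.map (algebraMap ℝ ℂ)).charpoly.rootMultiplicity z

/-- The set of all orthogonal square roots of `M`. -/
def OSR {n : ℕ} (M : Matrix (Fin n) (Fin n) ℝ) : Set (Matrix (Fin n) (Fin n) ℝ) :=
  {Y | Y ∈ Matrix.orthogonalGroup (Fin n) ℝ ∧ Y * Y = M}

/-- The orthogonal square roots of `M` with eigenvalues `1` (multiplicity `u`), `-1` (`h - u`),
`exp(± iθ_j/2)` (`μ_j` each), `exp(± i(θ_j/2 - π))` (`m_j - μ_j` each) and `± i` (`k` each). -/
def OSRStratum {n r : ℕ} (M : Matrix (Fin n) (Fin n) ℝ) (h : ℕ) (m : Fin r → ℕ) (k : ℕ)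
    (θ : Fin r → ℝ) (u : ℕ) (μ : Fin r → ℕ) : Set (Matrix (Fin n) (Fin n) ℝ) :=
  {Y | Y ∈ OSR M ∧
    eigMult Y 1 = u ∧ eigMult Y (-1) = h - u ∧
    (∀ j,
      eigMult Y (Complex.exp (Complex.I * ((θ j / 2 : ℝ) : ℂ))) = μ j ∧
      eigMult Y (Complex.exp (-(Complex.I * ((θ j / 2 : ℝ) : ℂ)))) = μ j ∧
      eigMult Y (Complex.exp (Complex.I * ((θ j / 2 - Real.pi : ℝ) : ℂ))) = m j - μ j ∧
      eigMult Y (Complex.exp (-(Complex.I * ((θ j / 2 - Real.pi : ℝ) : ℂ)))) = m j - μ j) ∧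
    eigMult Y Complex.I = k ∧ eigMult Y (-Complex.I) = k}

/-- The congruence `Γ_C : X ↦ C X Cᵀ`. -/
def congruence {n : ℕ} (C X : Matrix (Fin n) (Fin n) ℝ) : Matrix (Fin n) (Fin n) ℝ :=
  C * X * Cᵀ

/-- The non-singular Hermitian (for `𝕜 = ℝ`: symmetric) matrices with exactly `q` positive and
`p - q` negative eigenvalues, counted with multiplicity. -/
def hermSig (𝕜 : Type) [RCLike 𝕜] (p q : ℕ) : Set (Matrix (Fin p) (Fin p) 𝕜) :=
  {A | IsUnit A ∧ ∃ hA : A.IsHermitian,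
    Nat.card {i : Fin p // 0 < hA.eigenvalues i} = q ∧
    q + Nat.card {i : Fin p // hA.eigenvalues i < 0} = p}

/-- The set
`[O_h ∩ Sym_h(u)] ⊕ [⨁_j e^{iθ_j/2} (U_{m_j} ∩ Herm_{m_j}(μ_j))] ⊕ [O_{2k} ∩ so_{2k}]`, complex
matrices being viewed as real ones through `rho`. -/
def modelSet {n r h k : ℕ} {m : Fin r → ℕ} (hn : h + ((∑ j, m j * 2) + k * 2) = n)
    (θ : Fin r → ℝ) (u : ℕ) (μ : Fin r → ℕ) : Set (Matrix (Fin n) (Fin n) ℝ) :=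
  {Y | ∃ A ∈ (Matrix.orthogonalGroup (Fin h) ℝ : Set (Matrix (Fin h) (Fin h) ℝ)) ∩ hermSig ℝ h u,
    ∃ Z : ∀ j, Matrix (Fin (m j)) (Fin (m j)) ℂ,
    ∃ D ∈ Matrix.orthogonalGroup (Fin k × Fin 2) ℝ,
      (∀ j, Z j ∈ (Matrix.unitaryGroup (Fin (m j)) ℂ : Set (Matrix (Fin (m j)) (Fin (m j)) ℂ)) ∩
        hermSig ℂ (m j) (μ j)) ∧
      Dᵀ = -D ∧
      Y = blockSum hn A
        (fun j => rho (Complex.exp (Complex.I * ((θ j / 2 : ℝ) : ℂ)) • Z j)) D}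

/-- `C_B ∩ O_n`: the subgroup of the orthogonal matrices commuting with `B`. -/
def orthComm {n : ℕ} (B : Matrix (Fin n) (Fin n) ℝ) :
    Subgroup (Matrix.orthogonalGroup (Fin n) ℝ) where
  carrier := {X | B * (X : Matrix (Fin n) (Fin n) ℝ) = (X : Matrix (Fin n) (Fin n) ℝ) * B}
  one_mem' := by simp
  mul_mem' := by
    intro X Y hX hY
    simp only [Set.mem_ofPred_eq] at hX hY
    change B * ((X : Matrix (Fin n) (Fin n) ℝ) * (Y : Matrix (Fin n) (Fin n) ℝ)) =
      (X : Matrix (Fin n) (Fin n) ℝ) * (Y : Matrix (Fin n) (Fin n) ℝ) * B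
    rw [← mul_assoc, hX, mul_assoc, hY, mul_assoc]
  inv_mem' := by
    intro X hX
    simp only [Set.mem_ofPred_eq] at hX ⊢
    have h1 : ((X⁻¹ : Matrix.orthogonalGroup (Fin n) ℝ) : Matrix (Fin n) (Fin n) ℝ) *
        (X : Matrix (Fin n) (Fin n) ℝ) = 1 := congrArg Subtype.val (inv_mul_cancel X)
    have h2 : (X : Matrix (Fin n) (Fin n) ℝ) *
        ((X⁻¹ : Matrix.orthogonalGroup (Fin n) ℝ) : Matrix (Fin n) (Fin n) ℝ) = 1 :=
      congrArg Subtype.val (mul_inv_cancel X)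
    calc B * ((X⁻¹ : Matrix.orthogonalGroup (Fin n) ℝ) : Matrix (Fin n) (Fin n) ℝ)
        = (((X⁻¹ : Matrix.orthogonalGroup (Fin n) ℝ) : Matrix (Fin n) (Fin n) ℝ) *
            (X : Matrix (Fin n) (Fin n) ℝ)) * B *
            ((X⁻¹ : Matrix.orthogonalGroup (Fin n) ℝ) : Matrix (Fin n) (Fin n) ℝ) := by
          rw [h1, one_mul]
      _ = ((X⁻¹ : Matrix.orthogonalGroup (Fin n) ℝ) : Matrix (Fin n) (Fin n) ℝ) * B *
            ((X : Matrix (Fin n) (Fin n) ℝ) *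
            ((X⁻¹ : Matrix.orthogonalGroup (Fin n) ℝ) : Matrix (Fin n) (Fin n) ℝ)) := by
          rw [mul_assoc _ (X : Matrix (Fin n) (Fin n) ℝ) B, ← hX]; simp only [mul_assoc]
      _ = _ := by rw [h2, mul_one]

/-! ### Smooth structures -/

/-- A smooth (finite-dimensional, boundaryless) manifold structure on the space `X`, compatible with
its topology. -/
structure SmoothStructure (X : Type) [TopologicalSpace X] where
  /-- the dimension -/
  dim : ℕ
  /-- the atlas -/
  charts : ChartedSpace (EuclideanSpace ℝ (Fin dim)) X
  smooth : IsManifold (𝓡 dim) ∞ X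

/-- The standard smooth structure on `X ⊆ N`, where `N` is a real vector space: the one that makes
the inclusion into `N` a smooth embedding (it is unique if it exists). -/
def SmoothStructure.EmbedsInSpace {V : Type} [NormedAddCommGroup V] [NormedSpace ℝ V] {X : Type}
    [TopologicalSpace X] (𝒳 : SmoothStructure X) (ι : X → V) : Prop :=
  letI := 𝒳.charts
  IsSmoothEmbedding (𝓡 𝒳.dim) 𝓘(ℝ, V) ∞ ι

/-- `ι : X → Y` is a smooth embedding. For `ι` the inclusion of a subset `X` of `Y` this says that
`X`, with the smooth structure `𝒳`, is an embedded submanifold of `Y`; such an `𝒳` is unique. -/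
def SmoothStructure.EmbedsIn {X Y : Type} [TopologicalSpace X] [TopologicalSpace Y]
    (𝒳 : SmoothStructure X) (𝒴 : SmoothStructure Y) (ι : X → Y) : Prop :=
  letI := 𝒳.charts
  letI := 𝒴.charts
  IsSmoothEmbedding (𝓡 𝒳.dim) (𝓡 𝒴.dim) ∞ ι

/-- `π : X → Y` is a smooth submersion. For the projection `π : G → G ⧸ H` of a Lie group this
characterizes the smooth structure of the homogeneous space `G ⧸ H`. -/
def SmoothStructure.SubmersesOnto {X Y : Type} [TopologicalSpace X] [TopologicalSpace Y]
    (𝒳 : SmoothStructure X) (𝒴 : SmoothStructure Y) (π : X → Y) : Prop :=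
  letI := 𝒳.charts
  letI := 𝒴.charts
  Function.Surjective π ∧ IsSubmersion (𝓡 𝒳.dim) (𝓡 𝒴.dim) ∞ π

/-- There is a smooth diffeomorphism between `X` and `Y`. -/
def SmoothStructure.Diffeomorphic {X Y : Type} [TopologicalSpace X] [TopologicalSpace Y]
    (𝒳 : SmoothStructure X) (𝒴 : SmoothStructure Y) : Prop :=
  letI := 𝒳.charts
  letI := 𝒴.charts
  Nonempty (X ≃ₘ⟮𝓡 𝒳.dim, 𝓡 𝒴.dim⟯ Y)

end OrthRoots

end

/-! ### Algebra: block form, spectrum and orbit description of the orthogonal square roots. -/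

noncomputable section

namespace OrthRoots

open Polynomial

/-! ### Characteristic polynomials of Hermitian involutions -/

section CommRing

variable {R ι : Type*} [CommRing R]

/-! Algebra. Write `J` for the Jordan form. An orthogonal `Y` with `Y² = J` commutes with `J`, and
by orthogonality with `Jᵀ`, hence with `J + Jᵀ`, which is scalar on each block with distinct scalars
`2`, `2 cos θ_j`, `-2`. So `Y` is block diagonal. Its first block is an orthogonal involution, hence
symmetric. A middle block commutes with a multiple rotation with `sin θ_j ≠ 0`, hence is a complex
matrix, and dividing it by `e^{iθ_j/2}` leaves a unitary involution, hence a Hermitian one. The last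
block is orthogonal with square `-1`, hence skew (`exists_blocks_of_mem_OSR`).

Each Hermitian involution has a single invariant, the multiplicity of the eigenvalue `1` (`HasSig`).
Because `±1`, `±i`, `±e^{±iθ_j/2}` are pairwise distinct, the prescribed eigenvalue multiplicities
of `Y` are exactly these invariants (`block_mem_stratum_iff`), which gives the block sum
description. Involutions with equal invariant are unitarily conjugate (`HasSig.exists_conj`), and
orthogonal skew matrices are orthogonally conjugate to the standard complex structure
(`exists_conj_stdJ`). The blockwise conjugators commute with `J`, so the stratum is one orbit of the
centralizer of `J`.

Geometry. In the Cayley chart `v ↦ cay (v gᵀ)` around an orthogonal `g`, orthogonality becomes skew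
symmetry and commuting with `B` becomes a linear condition. For `v = q Y`, having the same square as
`Y` means `q Y q = Y`, that is, `cay q` anticommutes with `Y`. Such a `v` is moreover conjugate to
`Y` by `1 + q`, so it stays in the stratum (`squareRoots_slice`). Thus the orthogonal group, the
centralizer and the stratum are all flattened to linear subspaces by the same charts, and inclusions
become linear.

The orbit map induces a continuous bijection from the quotient of a compact group to a Hausdorff
space, hence a homeomorphism. The quotient receives its charts through it, so it is diffeomorphic to
the stratum. What has to be checked is that this is the right smooth structure, namely that the
projection is a submersion. If `W` anticommutes with `Y`, conjugating `Y` by `cay (t W / 2)`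
multiplies it by `cay (t W / 2)²`, a curve with velocity `W` in the chart at `Y`
(`hasDerivAt_orbit`). -/

lemma prod_X_sub_C_of_pm [Fintype ι] (c : R) (f : ι → R) (S : ι → Prop) [DecidablePred S]
    (hf : ∀ i, f i = if S i then c else -c) :
    ∏ i, (X - C (f i)) = (X - C c) ^ Fintype.card {i // S i} *
      (X + C c) ^ (Fintype.card ι - Fintype.card {i // S i}) := by
  have h : ∀ i, (X - C (f i)) = if S i then X - C c else X + C c := by
    intro i; rw [hf]; split_ifs <;> simp
  simp_rw [h, Finset.prod_ite, Finset.prod_const]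
  rw [← Fintype.card_subtype, ← Fintype.card_subtype, Fintype.card_subtype_compl]

lemma rootMultiplicity_pm_pow [IsDomain R] [DecidableEq R] (a b z : R) (p q : ℕ) :
    ((X - C a) ^ p * (X - C b) ^ q : R[X]).rootMultiplicity z =
      (if z = a then p else 0) + if z = b then q else 0 := by
  have h : ((X - C a) ^ p * (X - C b) ^ q : R[X]) ≠ 0 :=
    mul_ne_zero (pow_ne_zero _ (X_sub_C_ne_zero a)) (pow_ne_zero _ (X_sub_C_ne_zero b))
  rw [rootMultiplicity_mul h]
  congr 1 <;> simp only [← count_roots, roots_pow, roots_X_sub_C, Multiset.count_nsmul,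
    Multiset.count_singleton] <;> split_ifs <;> simp

lemma rootMultiplicity_finset_prod [IsDomain R] (s : Finset ι) (f : ι → R[X])
    (hf : ∀ i ∈ s, f i ≠ 0) (z : R) :
    (∏ i ∈ s, f i).rootMultiplicity z = ∑ i ∈ s, (f i).rootMultiplicity z := by
  classical
  rw [← count_roots, roots_prod _ _ (Finset.prod_ne_zero_iff.mpr hf), Multiset.count_bind]
  simp only [count_roots]
  rfl

/-- A block diagonal matrix is block triangular for the first index, so the determinant of its
characteristic matrix splits. The linear order on `o` serves only this argument. -/
lemma charpoly_blockDiagonal' {o : Type*} [Fintype o] [LinearOrder o] {m : o → Type*}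
    [∀ i, Fintype (m i)] [∀ i, DecidableEq (m i)] (B : ∀ i, Matrix (m i) (m i) R) :
    (Matrix.blockDiagonal' B).charpoly = ∏ i, (B i).charpoly := by
  have hT : (Matrix.blockDiagonal' B).BlockTriangular Sigma.fst := by
    rintro ⟨i, a⟩ ⟨j, b⟩ hij
    exact blockDiagonal'_apply_ne B a b (ne_of_gt hij)
  rw [Matrix.charpoly, (charmatrix_blockTriangular_iff.mpr hT).det_fintype]
  refine Finset.prod_congr rfl fun k _ => ?_
  rw [← charmatrix_toSquareBlock, ← Matrix.charpoly]
  let e : m k ≃ {a : Σ i, m i // a.fst = k} :=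
    { toFun := fun a => ⟨⟨k, a⟩, rfl⟩
      invFun := fun a => a.2 ▸ a.1.2
      left_inv := fun a => rfl
      right_inv := by rintro ⟨⟨i, a⟩, rfl⟩; rfl }
  rw [← charpoly_reindex e (B k)]
  congr 1
  ext ⟨⟨i, a⟩, rfl⟩ ⟨⟨j, b⟩, hj⟩
  obtain rfl : j = i := hj
  simp [toSquareBlock_def, e, blockDiagonal'_apply]

lemma charpoly_blockDiagonal {o m : Type*} [Fintype o] [DecidableEq o] [Fintype m]
    [DecidableEq m] (B : o → Matrix m m R) :
    (Matrix.blockDiagonal B).charpoly = ∏ i, (B i).charpoly := by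
  rw [Matrix.charpoly]
  have : (Matrix.blockDiagonal B).charmatrix = Matrix.blockDiagonal fun i => (B i).charmatrix := by
    ext ⟨i, a⟩ ⟨j, b⟩ : 2
    simp only [charmatrix_apply, blockDiagonal_apply, diagonal_apply, Prod.mk.injEq]
    by_cases hab : a = b <;> by_cases hij : i = j <;> simp [hab, hij]
  rw [this, det_blockDiagonal]
  rfl

end CommRing

section RCLike

variable {𝕜 ι : Type*} [RCLike 𝕜] [Fintype ι] [DecidableEq ι]

lemma charpoly_conj (U V A : Matrix ι ι 𝕜) (h : V * U = 1) :
    (U * A * V).charpoly = A.charpoly := by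
  rw [charpoly_mul_comm, ← mul_assoc, h, one_mul]

/-- The spectral theorem written as a product. -/
lemma hermitian_eq_mul {A : Matrix ι ι 𝕜} (hA : A.IsHermitian) :
    A = (hA.eigenvectorUnitary : Matrix ι ι 𝕜) * diagonal (RCLike.ofReal ∘ hA.eigenvalues) *
      star (hA.eigenvectorUnitary : Matrix ι ι 𝕜) := by
  conv_lhs => rw [hA.spectral_theorem, Unitary.conjStarAlgAut_apply]

lemma charpoly_smul_hermitian {A : Matrix ι ι 𝕜} (hA : A.IsHermitian) (c : 𝕜) :
    (c • A).charpoly = ∏ i, (X - C (c * (hA.eigenvalues i : 𝕜))) := by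
  have h : c • A = (hA.eigenvectorUnitary : Matrix ι ι 𝕜) *
      diagonal (fun i => c * (hA.eigenvalues i : 𝕜)) *
      star (hA.eigenvectorUnitary : Matrix ι ι 𝕜) := by
    conv_lhs => rw [hermitian_eq_mul hA]
    rw [← Matrix.smul_mul, ← Matrix.mul_smul]
    congr 2
    ext i j
    by_cases hij : i = j <;> simp [hij]
  rw [h, charpoly_conj _ _ _ (Unitary.coe_star_mul_self _), charpoly_diagonal]

lemma eigenvalues_of_involution {A : Matrix ι ι 𝕜} (hA : A.IsHermitian) (hA2 : A * A = 1)
    (i : ι) : hA.eigenvalues i = 1 ∨ hA.eigenvalues i = -1 := by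
  have h1 := hA.mulVec_eigenvectorBasis i
  have h2 : A *ᵥ (A *ᵥ ⇑(hA.eigenvectorBasis i)) =
      (hA.eigenvalues i * hA.eigenvalues i) • ⇑(hA.eigenvectorBasis i) := by
    rw [h1, mulVec_smul, h1, smul_smul]
  rw [mulVec_mulVec, hA2, one_mulVec] at h2
  have h0 : (⇑(hA.eigenvectorBasis i) : ι → 𝕜) ≠ 0 := by
    intro h
    apply hA.eigenvectorBasis.orthonormal.ne_zero i
    ext j
    exact congrFun h j
  obtain ⟨j, hj⟩ := Function.ne_iff.mp h0
  have h3 := congrFun h2 j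
  simp only [Pi.smul_apply, RCLike.real_smul_eq_coe_mul] at h3
  have h4 : ((hA.eigenvalues i * hA.eigenvalues i : ℝ) : 𝕜) = 1 :=
    mul_right_cancel₀ hj (by rw [one_mul]; exact h3.symm)
  exact mul_self_eq_one_iff.mp (by exact_mod_cast h4)

lemma charpoly_smul_involution {A : Matrix ι ι 𝕜} (hA : A.IsHermitian) (hA2 : A * A = 1)
    (c : 𝕜) :
    (c • A).charpoly = (X - C c) ^ Fintype.card {i // 0 < hA.eigenvalues i} *
      (X + C c) ^ (Fintype.card ι - Fintype.card {i // 0 < hA.eigenvalues i}) := by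
  rw [charpoly_smul_hermitian hA]
  refine prod_X_sub_C_of_pm c _ _ fun i => ?_
  rcases eigenvalues_of_involution hA hA2 i with h | h <;> rw [h] <;> norm_num

/-- `HasSig A q`: the matrix `A` is Hermitian and an involution, and `1` is an eigenvalue
of multiplicity `q`. -/
structure HasSig (A : Matrix ι ι 𝕜) (q : ℕ) : Prop where
  herm : A.IsHermitian
  sq : A * A = 1
  card_pos : Fintype.card {i // 0 < herm.eigenvalues i} = q

lemma exists_hasSig {A : Matrix ι ι 𝕜} (hA : A.IsHermitian) (hA2 : A * A = 1) :
    ∃ q, HasSig A q := ⟨_, hA, hA2, rfl⟩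

lemma HasSig.le {A : Matrix ι ι 𝕜} {q : ℕ} (h : HasSig A q) : q ≤ Fintype.card ι :=
  h.card_pos ▸ Fintype.card_subtype_le _

lemma HasSig.charpoly_smul {A : Matrix ι ι 𝕜} {q : ℕ} (h : HasSig A q) (c : 𝕜) :
    (c • A).charpoly = (X - C c) ^ q * (X + C c) ^ (Fintype.card ι - q) := by
  rw [charpoly_smul_involution h.herm h.sq, h.card_pos]

lemma HasSig.charpoly {A : Matrix ι ι 𝕜} {q : ℕ} (h : HasSig A q) :
    A.charpoly = (X - 1) ^ q * (X + 1) ^ (Fintype.card ι - q) := by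
  simpa using h.charpoly_smul 1

/-- Some signature exists, and as `1 ≠ -1` it is recovered as the multiplicity of the root `1`. -/
lemma hasSig_of_charpoly {A : Matrix ι ι 𝕜} {q : ℕ} (hA : A.IsHermitian) (hA2 : A * A = 1)
    (hc : A.charpoly = (X - 1) ^ q * (X + 1) ^ (Fintype.card ι - q)) : HasSig A q := by
  classical
  obtain ⟨q', h⟩ := exists_hasSig hA hA2
  have h1 := h.charpoly
  rw [hc] at h1
  have h2 := congrArg (rootMultiplicity (1 : 𝕜)) h1
  have e : ∀ r : ℕ, ((X - 1) ^ r * (X + 1) ^ (Fintype.card ι - r) : 𝕜[X]) =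
    (X - C 1) ^ r * (X - C (-1)) ^ (Fintype.card ι - r) := by simp
  have h3 : (1 : 𝕜) ≠ -1 := by norm_num
  rw [e, e, rootMultiplicity_pm_pow, rootMultiplicity_pm_pow] at h2
  simp only [if_true, h3, if_false, add_zero] at h2
  exact h2 ▸ h

/-- Equal characteristic polynomials give equal eigenvalue functions, so both matrices diagonalize
to the same diagonal matrix, and one eigenvector unitary times the inverse of the other conjugates
them. -/
lemma HasSig.exists_conj {A B : Matrix ι ι 𝕜} {q : ℕ} (hA : HasSig A q) (hB : HasSig B q) :
    ∃ U ∈ Matrix.unitaryGroup ι 𝕜, A = U * B * star U := by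
  have h : hA.herm.eigenvalues = hB.herm.eigenvalues :=
    (Matrix.IsHermitian.eigenvalues_eq_eigenvalues_iff hA.herm hB.herm).mpr (hA.charpoly.trans hB.charpoly.symm)
  refine ⟨hA.herm.eigenvectorUnitary * star hB.herm.eigenvectorUnitary,
    (hA.herm.eigenvectorUnitary * star hB.herm.eigenvectorUnitary).2, ?_⟩
  conv_lhs => rw [hermitian_eq_mul hA.herm]
  have h2 := hermitian_eq_mul hB.herm
  set V := hB.herm.eigenvectorUnitary
  set U := hA.herm.eigenvectorUnitary
  rw [h2]
  have e1 : star (V : Matrix ι ι 𝕜) * V = 1 := Unitary.coe_star_mul_self V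
  simp only [star_mul, Unitary.coe_star, star_star, mul_assoc]
  rw [← mul_assoc (star (V : Matrix ι ι 𝕜)) V, e1, one_mul,
    ← mul_assoc (star (V : Matrix ι ι 𝕜)) V, e1, one_mul, h]

lemma HasSig.mem_unitary {A : Matrix ι ι 𝕜} {q : ℕ} (h : HasSig A q) :
    A ∈ Matrix.unitaryGroup ι 𝕜 := by
  rw [Matrix.mem_unitaryGroup_iff, star_eq_conjTranspose, h.herm.eq, h.sq]

lemma hasSig_diagonal (S : ι → Prop) [DecidablePred S] :
    HasSig (diagonal fun i => if S i then (1 : 𝕜) else -1) (Fintype.card {i // S i}) := by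
  refine hasSig_of_charpoly ?_ ?_ ?_
  · rw [Matrix.IsHermitian, diagonal_conjTranspose]
    congr 1; ext i; by_cases h : S i <;> simp [h]
  · rw [diagonal_mul_diagonal, ← diagonal_one]
    congr 1; ext i; by_cases h : S i <;> simp [h]
  · rw [charpoly_diagonal, prod_X_sub_C_of_pm 1 _ S (fun i => rfl)]; simp

end RCLike

lemma HasSig.map_ofReal {ι : Type*} [Fintype ι] [DecidableEq ι] {A : Matrix ι ι ℝ} {q : ℕ}
    (h : HasSig A q) : HasSig (A.map (algebraMap ℝ ℂ)) q := by
  refine hasSig_of_charpoly ?_ ?_ ?_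
  · ext i j
    have := congrFun (congrFun h.herm i) j
    simp only [conjTranspose_apply, star_trivial] at this
    simp [this]
  · have := congrArg (fun M => M.map (algebraMap ℝ ℂ)) h.sq
    rwa [Matrix.map_mul, Matrix.map_one _ (map_zero _) (map_one _)] at this
  · rw [charpoly_map, h.charpoly]; simp

lemma card_fin_lt {p q : ℕ} (h : q ≤ p) : Fintype.card {i : Fin p // i.val < q} = q := by
  rw [Fintype.card_subtype]
  have : (Finset.univ.filter fun i : Fin p => i.val < q) = (Finset.univ : Finset (Fin q)).map (Fin.castLEEmb h) := by
    ext i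
    simp only [Finset.mem_filter, Finset.mem_univ, true_and, Finset.mem_map, Fin.castLEEmb_apply]
    exact ⟨fun hi => ⟨⟨i, hi⟩, rfl⟩, by rintro ⟨a, rfl⟩; exact a.2⟩
  rw [this]; simp

/-- A Hermitian unitary matrix is an involution, so its eigenvalues are `±1`. Nonsingularity and the
count of negative eigenvalues then follow from the count of positive ones. -/
lemma mem_hermSig_iff {𝕜 : Type} [RCLike 𝕜] {p q : ℕ} {A : Matrix (Fin p) (Fin p) 𝕜}
    (hA : A ∈ Matrix.unitaryGroup (Fin p) 𝕜) : A ∈ hermSig 𝕜 p q ↔ HasSig A q := by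
  have aux : ∀ hH : A.IsHermitian, A * A = 1 := fun hH => by
    have := Matrix.mem_unitaryGroup_iff.mp hA
    rwa [star_eq_conjTranspose, hH.eq] at this
  constructor
  · rintro ⟨-, hH, h1, -⟩
    exact ⟨hH, aux hH, by rw [← h1, Nat.card_eq_fintype_card]⟩
  · intro h
    refine ⟨IsUnit.of_mul_eq_one _ h.sq, h.herm, ?_, ?_⟩
    · rw [Nat.card_eq_fintype_card, h.card_pos]
    · rw [Nat.card_eq_fintype_card]
      have e : Fintype.card {i // h.herm.eigenvalues i < 0} =
          Fintype.card {i // ¬ 0 < h.herm.eigenvalues i} :=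
        Fintype.card_congr (Equiv.subtypeEquivRight fun i => by
          rcases eigenvalues_of_involution h.herm h.sq i with h | h <;> rw [h] <;> norm_num)
      rw [e, Fintype.card_subtype_compl, h.card_pos]
      have := h.le
      simp only [Fintype.card_fin] at this ⊢
      omega

/-! ### Orthogonal matrices -/

section Orthogonal

variable {ι : Type*} [Fintype ι] [DecidableEq ι]

lemma mem_orthogonalGroup_iff_mul_transpose {A : Matrix ι ι ℝ} :
    A ∈ Matrix.orthogonalGroup ι ℝ ↔ A * Aᵀ = 1 := Matrix.mem_orthogonalGroup_iff ι ℝ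

lemma mem_orthogonalGroup_iff_transpose_mul {A : Matrix ι ι ℝ} :
    A ∈ Matrix.orthogonalGroup ι ℝ ↔ Aᵀ * A = 1 := Matrix.mem_orthogonalGroup_iff' ι ℝ

lemma mul_mem_orthogonalGroup {A B : Matrix ι ι ℝ} (hA : A ∈ Matrix.orthogonalGroup ι ℝ)
    (hB : B ∈ Matrix.orthogonalGroup ι ℝ) : A * B ∈ Matrix.orthogonalGroup ι ℝ :=
  mul_mem hA hB

lemma transpose_mem_orthogonalGroup {A : Matrix ι ι ℝ} (hA : A ∈ Matrix.orthogonalGroup ι ℝ) :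
    Aᵀ ∈ Matrix.orthogonalGroup ι ℝ := by
  rw [mem_orthogonalGroup_iff_mul_transpose, transpose_transpose]
  exact mem_orthogonalGroup_iff_transpose_mul.mp hA

/-- Transposing the relation shows that `Yᵀ` commutes with `Jᵀ`, and `Y` is the inverse of `Yᵀ`. -/
lemma commute_transpose_of_orthogonal {Y J : Matrix ι ι ℝ} (hY : Y ∈ Matrix.orthogonalGroup ι ℝ)
    (h : Y * J = J * Y) : Y * Jᵀ = Jᵀ * Y := by
  have h1 := mem_orthogonalGroup_iff_mul_transpose.mp hY
  have h2 := mem_orthogonalGroup_iff_transpose_mul.mp hY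
  have h3 : Jᵀ * Yᵀ = Yᵀ * Jᵀ := by rw [← transpose_mul, h, transpose_mul]
  calc Y * Jᵀ = Y * Jᵀ * (Yᵀ * Y) := by rw [h2, mul_one]
    _ = Y * (Jᵀ * Yᵀ) * Y := by simp only [mul_assoc]
    _ = (Y * Yᵀ) * Jᵀ * Y := by rw [h3]; simp only [mul_assoc]
    _ = Jᵀ * Y := by rw [h1, one_mul]

end Orthogonal

/-! ### The embedding `rho` -/

section Rho

variable {m : ℕ}

lemma rho_mul (Z W : Matrix (Fin m) (Fin m) ℂ) : rho (Z * W) = rho Z * rho W := by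
  ext ⟨a, s⟩ ⟨b, t⟩
  simp only [rho, of_apply, mul_apply, Fintype.sum_prod_type, Fin.sum_univ_two, Complex.re_sum,
    Complex.im_sum, Complex.mul_re, Complex.mul_im]
  fin_cases s <;> fin_cases t <;> simp only [Fin.isValue, Fin.zero_eta, Fin.mk_one,
    cons_val', cons_val_zero, cons_val_one, cons_val_fin_one, ← Finset.sum_neg_distrib] <;> exact Finset.sum_congr rfl fun c _ => by ring

lemma rho_conjTranspose (Z : Matrix (Fin m) (Fin m) ℂ) : rho Zᴴ = (rho Z)ᵀ := by
  ext ⟨a, s⟩ ⟨b, t⟩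
  fin_cases s <;> fin_cases t <;> simp [rho]

lemma rho_injective : Function.Injective (rho (m := m)) := by
  intro Z W h
  ext a b
  apply Complex.ext
  · simpa [rho] using congrFun (congrFun h (a, 0)) (b, 0)
  · simpa [rho] using congrFun (congrFun h (a, 1)) (b, 0)

lemma rho_one : rho (1 : Matrix (Fin m) (Fin m) ℂ) = 1 := by
  ext ⟨a, s⟩ ⟨b, t⟩
  by_cases hab : a = b <;> fin_cases s <;> fin_cases t <;> simp [rho, one_apply, hab]

lemma rho_neg (Z : Matrix (Fin m) (Fin m) ℂ) : rho (-Z) = -rho Z := by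
  ext ⟨a, s⟩ ⟨b, t⟩
  fin_cases s <;> fin_cases t <;> simp [rho]

lemma rotBlocks_eq_rho (φ : Fin m → ℝ) :
    rotBlocks φ = rho (diagonal fun a => Complex.exp (Complex.I * (φ a : ℂ))) := by
  ext ⟨a, s⟩ ⟨b, t⟩
  by_cases hab : a = b
  · subst hab
    fin_cases s <;> fin_cases t <;>
      simp [rotBlocks, rho, rot, mul_comm Complex.I, Complex.exp_ofReal_mul_I_re,
        Complex.exp_ofReal_mul_I_im]
  · fin_cases s <;> fin_cases t <;> simp [rotBlocks, rho, hab]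

lemma rho_orthogonal_iff {Z : Matrix (Fin m) (Fin m) ℂ} :
    rho Z * (rho Z)ᵀ = 1 ↔ Z ∈ Matrix.unitaryGroup (Fin m) ℂ := by
  rw [← rho_conjTranspose, ← rho_mul, ← rho_one, rho_injective.eq_iff,
    Matrix.mem_unitaryGroup_iff, star_eq_conjTranspose]

/-- A matrix commuting with `E_θ ⊕ ⋯ ⊕ E_θ` with `sin θ ≠ 0` is the image of a complex matrix. -/
lemma exists_rho_of_commute {c : ℂ} (hc : c.im ≠ 0)
    {B : Matrix (Fin m × Fin 2) (Fin m × Fin 2) ℝ}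
    (h : B * rho (c • 1) = rho (c • 1) * B) : ∃ W, B = rho W := by
  refine ⟨Matrix.of fun a b => ⟨B (a, 0) (b, 0), B (a, 1) (b, 0)⟩, ?_⟩
  -- In the two entries compared, the terms with `c.re` cancel and the wanted relation remains,
  -- multiplied by `c.im`.
  have key : ∀ a b, B (a, 0) (b, 1) = - B (a, 1) (b, 0) ∧ B (a, 1) (b, 1) = B (a, 0) (b, 0) := by
    intro a b
    have h0 := congrFun (congrFun h (a, 0)) (b, 0)
    have h1 := congrFun (congrFun h (a, 0)) (b, 1)
    simp only [mul_apply, Fintype.sum_prod_type, Fin.sum_univ_two, rho, of_apply, Matrix.smul_apply,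
      one_apply, smul_eq_mul, mul_ite, mul_one, mul_zero, Fin.isValue, cons_val', cons_val_zero,
      cons_val_one, cons_val_fin_one, apply_ite Complex.re, apply_ite Complex.im,
      Complex.zero_re, Complex.zero_im, ite_mul, zero_mul, neg_mul, mul_neg, Finset.sum_neg_distrib,
      Finset.sum_add_distrib, Finset.sum_ite_eq, Finset.sum_ite_eq', Finset.mem_univ, if_true]
      at h0 h1
    constructor
    · apply mul_right_cancel₀ hc; linarith
    · apply mul_right_cancel₀ hc; linarith
  ext ⟨a, s⟩ ⟨b, t⟩
  fin_cases s <;> fin_cases t <;> simp [rho, key]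

/-- The vectors `(1, -i)` and `(1, i)` are eigenvectors of every block `Re z I + Im z E_{π/2}`, with
eigenvalues `z` and its conjugate. Passing to this basis (the columns of `P`) in each pair of
coordinates turns `rho Z` into the direct sum of `Z` and its entrywise conjugate. -/
lemma charpoly_rho_map (Z : Matrix (Fin m) (Fin m) ℂ) :
    ((rho Z).map (algebraMap ℝ ℂ)).charpoly =
      Z.charpoly * (Z.map (starRingEnd ℂ)).charpoly := by
  let E : Matrix (Fin 2) (Fin 2) ℂ → Matrix (Fin m × Fin 2) (Fin m × Fin 2) ℂ := fun t =>
    Matrix.of fun p q => if p.1 = q.1 then t p.2 q.2 else 0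
  let P := E !![1, 1; -Complex.I, Complex.I]
  let Q := E !![1 / 2, Complex.I / 2; 1 / 2, -Complex.I / 2]
  have hQP : Q * P = 1 := by
    ext ⟨a, s⟩ ⟨b, t⟩
    simp only [P, Q, E, mul_apply, Fintype.sum_prod_type, Fin.sum_univ_two, of_apply, one_apply]
    by_cases hab : a = b
    · fin_cases s <;> fin_cases t <;>
        simp [hab, Finset.sum_add_distrib] <;> ring_nf <;> simp <;> norm_num
    · fin_cases s <;> fin_cases t <;>
        simp [hab, Finset.sum_add_distrib]
  have hPQ : P * Q = 1 := mul_eq_one_comm.mp hQP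
  have h1 : (rho Z).map (algebraMap ℝ ℂ) * P =
      P * Matrix.blockDiagonal ![Z, Z.map (starRingEnd ℂ)] := by
    ext ⟨a, s⟩ ⟨b, t⟩
    simp only [P, E, mul_apply, Fintype.sum_prod_type, Fin.sum_univ_two, of_apply, map_apply, rho,
      blockDiagonal_apply]
    fin_cases s <;> fin_cases t <;>
      simp [Finset.sum_add_distrib] <;> apply Complex.ext <;> simp
  have h2 : (rho Z).map (algebraMap ℝ ℂ) =
      P * Matrix.blockDiagonal ![Z, Z.map (starRingEnd ℂ)] * Q := by
    rw [← h1, mul_assoc, hPQ, mul_one]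
  rw [h2, charpoly_conj _ _ _ hQP, charpoly_blockDiagonal, Fin.prod_univ_two]
  rfl

end Rho

/-! ### Block sums -/

section BlockSum

variable {n r h k : ℕ} {m : Fin r → ℕ} (hn : h + ((∑ j, m j * 2) + k * 2) = n)

lemma blockSum_mul (A A' : Matrix (Fin h) (Fin h) ℝ)
    (B B' : ∀ j, Matrix (Fin (m j) × Fin 2) (Fin (m j) × Fin 2) ℝ)
    (D D' : Matrix (Fin k × Fin 2) (Fin k × Fin 2) ℝ) :
    blockSum hn A B D * blockSum hn A' B' D' =
      blockSum hn (A * A') (fun j => B j * B' j) (D * D') := by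
  simp only [blockSum, reindex_apply, submatrix_mul_equiv, fromBlocks_multiply]
  simp [blockDiagonal'_mul]

lemma blockSum_add (A A' : Matrix (Fin h) (Fin h) ℝ)
    (B B' : ∀ j, Matrix (Fin (m j) × Fin 2) (Fin (m j) × Fin 2) ℝ)
    (D D' : Matrix (Fin k × Fin 2) (Fin k × Fin 2) ℝ) :
    blockSum hn A B D + blockSum hn A' B' D' =
      blockSum hn (A + A') (fun j => B j + B' j) (D + D') := by
  have : (fun j => B j + B' j) = B + B' := rfl
  rw [this]
  simp only [blockSum, reindex_apply, blockDiagonal'_add]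
  ext i j
  rw [Matrix.add_apply]
  simp only [submatrix_apply]
  rw [← Matrix.add_apply, fromBlocks_add, fromBlocks_add]
  simp only [add_zero]

lemma blockSum_transpose (A : Matrix (Fin h) (Fin h) ℝ)
    (B : ∀ j, Matrix (Fin (m j) × Fin 2) (Fin (m j) × Fin 2) ℝ)
    (D : Matrix (Fin k × Fin 2) (Fin k × Fin 2) ℝ) :
    (blockSum hn A B D)ᵀ = blockSum hn Aᵀ (fun j => (B j)ᵀ) Dᵀ := by
  simp only [blockSum, reindex_apply, transpose_submatrix, fromBlocks_transpose,
    blockDiagonal'_transpose, transpose_zero]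

lemma blockSum_one : blockSum (m := m) hn 1 (fun _ => 1) 1 = 1 := by
  have : (fun j : Fin r => (1 : Matrix (Fin (m j) × Fin 2) (Fin (m j) × Fin 2) ℝ)) = 1 := rfl
  rw [blockSum, this, blockDiagonal'_one, fromBlocks_one, fromBlocks_one, reindex_apply,
    submatrix_one_equiv]

lemma blockSum_inj {A A' : Matrix (Fin h) (Fin h) ℝ}
    {B B' : ∀ j, Matrix (Fin (m j) × Fin 2) (Fin (m j) × Fin 2) ℝ}
    {D D' : Matrix (Fin k × Fin 2) (Fin k × Fin 2) ℝ} :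
    blockSum hn A B D = blockSum hn A' B' D' ↔ A = A' ∧ (∀ j, B j = B' j) ∧ D = D' := by
  rw [blockSum, blockSum, EmbeddingLike.apply_eq_iff_eq, fromBlocks_inj, fromBlocks_inj,
    blockDiagonal'_inj, funext_iff]
  simp

lemma charpoly_blockSum_map (A : Matrix (Fin h) (Fin h) ℝ)
    (B : ∀ j, Matrix (Fin (m j) × Fin 2) (Fin (m j) × Fin 2) ℝ)
    (D : Matrix (Fin k × Fin 2) (Fin k × Fin 2) ℝ) :
    ((blockSum hn A B D).map (algebraMap ℝ ℂ)).charpoly =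
      (A.map (algebraMap ℝ ℂ)).charpoly *
        ((∏ j, ((B j).map (algebraMap ℝ ℂ)).charpoly) * (D.map (algebraMap ℝ ℂ)).charpoly) := by
  simp only [charpoly_map]
  rw [blockSum, charpoly_reindex, charpoly_fromBlocks_zero₁₂, charpoly_fromBlocks_zero₁₂,
    charpoly_blockDiagonal', Polynomial.map_mul, Polynomial.map_mul, Polynomial.map_prod]

lemma blockSum_mem_orthogonalGroup_iff {A : Matrix (Fin h) (Fin h) ℝ}
    {B : ∀ j, Matrix (Fin (m j) × Fin 2) (Fin (m j) × Fin 2) ℝ}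
    {D : Matrix (Fin k × Fin 2) (Fin k × Fin 2) ℝ} :
    blockSum hn A B D ∈ Matrix.orthogonalGroup (Fin n) ℝ ↔
      A * Aᵀ = 1 ∧ (∀ j, B j * (B j)ᵀ = 1) ∧ D * Dᵀ = 1 := by
  rw [mem_orthogonalGroup_iff_mul_transpose, blockSum_transpose, blockSum_mul, ← blockSum_one hn,
    blockSum_inj]

/-- A matrix commuting with a block scalar matrix with distinct scalars is block diagonal. -/
lemma exists_blockSum_of_commute {c : Fin r → ℝ} (hc : Function.Injective c)
    (hc1 : ∀ j, c j ≠ 1) (hc2 : ∀ j, c j ≠ -1) {Y : Matrix (Fin n) (Fin n) ℝ}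
    (hY : Y * blockSum (m := m) hn 1 (fun j => c j • 1) (-1) =
      blockSum hn 1 (fun j => c j • 1) (-1) * Y) :
    ∃ A B D, Y = blockSum (m := m) hn A B D := by
  let d : BlockIdx h m k → ℝ := Sum.elim (fun _ => 1) (Sum.elim (fun p => c p.1) fun _ => -1)
  have hd : blockSum (m := m) hn 1 (fun j => c j • 1) (-1) =
      Matrix.reindex (blockEquiv hn) (blockEquiv hn) (diagonal d) := by
    rw [blockSum]
    congr 1
    ext (i | ⟨i, a⟩ | i) (j | ⟨j, b⟩ | j)
    · simp [diagonal_apply, one_apply, d]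
    · simp [d]
    · simp [d]
    · simp [d]
    · by_cases hij : i = j
      · subst hij
        simp [diagonal_apply, one_apply, d, blockDiagonal'_apply, Sigma.mk.injEq]
      · simp [d, blockDiagonal'_apply, hij]
    · simp [d]
    · simp [d]
    · simp [d]
    · by_cases hij : i = j <;> simp [d, hij]
  set Y' := Y.submatrix (blockEquiv hn) (blockEquiv (m := m) hn) with hY'
  have hYY : Y = Matrix.reindex (blockEquiv hn) (blockEquiv hn) Y' := by
    ext i j; simp [hY']
  rw [hd, hYY, reindex_apply, reindex_apply, submatrix_mul_equiv, submatrix_mul_equiv] at hY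
  have h1 : Y' * diagonal d = diagonal d * Y' := by
    ext i j
    simpa using congrFun (congrFun hY (blockEquiv hn i)) (blockEquiv hn j)
  have h2 : ∀ i j, d i ≠ d j → Y' i j = 0 := by
    intro i j hij
    have := congrFun (congrFun h1 i) j
    rw [mul_diagonal, diagonal_mul, mul_comm] at this
    by_contra h0
    exact hij (mul_right_cancel₀ h0 this).symm
  refine ⟨Y'.submatrix Sum.inl Sum.inl,
    fun j => Y'.submatrix (fun a => Sum.inr (Sum.inl ⟨j, a⟩)) (fun a => Sum.inr (Sum.inl ⟨j, a⟩)),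
    Y'.submatrix (fun a => Sum.inr (Sum.inr a)) (fun a => Sum.inr (Sum.inr a)), ?_⟩
  rw [hYY, blockSum]
  congr 1
  ext (i | ⟨i, a⟩ | i) (j | ⟨j, b⟩ | j)
  · simp
  · simpa using h2 _ _ (by simpa [d] using (hc1 j).symm)
  · simpa using h2 _ _ (by simp [d]; norm_num)
  · simpa using h2 _ _ (by simpa [d] using hc1 i)
  · by_cases hij : i = j
    · subst hij; simp [blockDiagonal'_apply]
    · simpa [blockDiagonal'_apply, hij] using h2 _ _ (by simpa [d] using hc.ne hij)
  · simpa using h2 _ _ (by simpa [d] using hc2 i)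
  · simpa using h2 _ _ (by simp [d]; norm_num)
  · simpa using h2 _ _ (by simpa [d] using (hc2 j).symm)
  · simp

end BlockSum

/-! ### Orthogonal complex structures -/

section Skew

variable {k : ℕ}

/-- The standard complex structure `E_{π/2} ⊕ ⋯ ⊕ E_{π/2}`. -/
def stdJ (k : ℕ) : Matrix (Fin k × Fin 2) (Fin k × Fin 2) ℝ := rho (Complex.I • 1)

lemma stdJ_transpose : (stdJ k)ᵀ = -stdJ k := by
  rw [stdJ, ← rho_conjTranspose, ← rho_neg]
  congr 1
  rw [conjTranspose_smul, conjTranspose_one]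
  simp

lemma stdJ_mem : stdJ k ∈ Matrix.orthogonalGroup (Fin k × Fin 2) ℝ := by
  rw [mem_orthogonalGroup_iff_mul_transpose, stdJ, rho_orthogonal_iff,
    Matrix.mem_unitaryGroup_iff, star_eq_conjTranspose, conjTranspose_smul, conjTranspose_one,
    smul_mul_smul_comm]
  simp

lemma skew_sq {ι : Type*} [Fintype ι] [DecidableEq ι] {D : Matrix ι ι ℝ}
    (hD : D ∈ Matrix.orthogonalGroup ι ℝ) (hs : Dᵀ = -D) : D * D = -1 := by
  have := mem_orthogonalGroup_iff_mul_transpose.mp hD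
  rw [hs, mul_neg] at this
  rw [← this, neg_neg]

/-- The trace is the number of eigenvalues `1` minus the number of eigenvalues `-1`. -/
lemma HasSig.of_trace_zero {ι : Type*} [Fintype ι] [DecidableEq ι] {H : Matrix ι ι ℂ}
    (hH : H.IsHermitian) (hH2 : H * H = 1) (ht : H.trace = 0) {q : ℕ}
    (hq : Fintype.card ι = 2 * q) : HasSig H q := by
  refine ⟨hH, hH2, ?_⟩
  have h1 := hH.trace_eq_sum_eigenvalues
  rw [ht] at h1
  have h2 : ∑ i, hH.eigenvalues i = 0 := by
    simpa using congrArg Complex.re h1.symm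
  have h3 : ∀ i, hH.eigenvalues i = if 0 < hH.eigenvalues i then 1 else -1 := by
    intro i
    rcases eigenvalues_of_involution hH hH2 i with h | h <;> rw [h] <;> norm_num
  rw [Finset.sum_congr rfl fun i _ => h3 i, Finset.sum_ite, Finset.sum_const, Finset.sum_const,
    ← Fintype.card_subtype, ← Fintype.card_subtype, Fintype.card_subtype_compl] at h2
  have h4 := Fintype.card_subtype_le fun i => 0 < hH.eigenvalues i
  simp only [nsmul_eq_mul, mul_one, mul_neg, Nat.cast_sub h4] at h2
  have h5 : (2 * Fintype.card {i // 0 < hH.eigenvalues i} : ℝ) = Fintype.card ι := by linarith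
  have h6 : 2 * Fintype.card {i // 0 < hH.eigenvalues i} = Fintype.card ι := by exact_mod_cast h5
  omega

/-- Multiplying by `i` turns a real skew matrix with square `-1` into a Hermitian involution. Its
trace vanishes with the diagonal of `D`, so the signature is forced and gives no further invariant.
-/
lemma hasSig_of_skew {D : Matrix (Fin k × Fin 2) (Fin k × Fin 2) ℝ}
    (hD : D ∈ Matrix.orthogonalGroup (Fin k × Fin 2) ℝ) (hs : Dᵀ = -D) :
    HasSig (Complex.I • D.map (algebraMap ℝ ℂ)) k := by
  have e : ∀ i j, D j i = - D i j := fun i j => congrFun (congrFun hs i) j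
  refine HasSig.of_trace_zero ?_ ?_ ?_ ?_
  · ext i j
    simp [e i j]
  · have h1 : (D * D).map (algebraMap ℝ ℂ) = -1 := by
      rw [skew_sq hD hs]; ext i j
      by_cases hij : i = j <;> simp [hij]
    rw [Matrix.map_mul] at h1
    rw [smul_mul_smul_comm, h1]; simp
  · rw [trace_smul]
    have : (D.map (algebraMap ℝ ℂ)).trace = 0 :=
      Finset.sum_eq_zero fun i _ => by
        have := e i i
        have h0 : D i i = 0 := by linarith
        simp [h0]
    rw [this, smul_zero]
  · simp [mul_comm]

lemma charpoly_skew_map {D : Matrix (Fin k × Fin 2) (Fin k × Fin 2) ℝ}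
    (hD : D ∈ Matrix.orthogonalGroup (Fin k × Fin 2) ℝ) (hs : Dᵀ = -D) :
    (D.map (algebraMap ℝ ℂ)).charpoly = (X - C Complex.I) ^ k * (X - C (-Complex.I)) ^ k := by
  have h : D.map (algebraMap ℝ ℂ) = (-Complex.I) • (Complex.I • D.map (algebraMap ℝ ℂ)) := by
    rw [smul_smul]; simp
  rw [h, (hasSig_of_skew hD hs).charpoly_smul]
  have : Fintype.card (Fin k × Fin 2) - k = k := by simp; omega
  rw [this, mul_comm]
  simp [sub_eq_add_neg]

/-- Orthogonal complex structures are orthogonally conjugate to the standard one. -/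
lemma exists_conj_stdJ {D : Matrix (Fin k × Fin 2) (Fin k × Fin 2) ℝ}
    (hD : D ∈ Matrix.orthogonalGroup (Fin k × Fin 2) ℝ) (hs : Dᵀ = -D) :
    ∃ O ∈ Matrix.orthogonalGroup (Fin k × Fin 2) ℝ, D = O * stdJ k * Oᵀ := by
  -- The conjugation obtained here is only unitary; a real one is built below from the
  -- `i`-eigenspace of `D`.
  obtain ⟨U, hU, hUD⟩ := (hasSig_of_skew hD hs).exists_conj (hasSig_of_skew stdJ_mem stdJ_transpose)
  have hU1 : star U * U = 1 := Matrix.mem_unitaryGroup_iff'.mp hU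
  have hDU : D.map (algebraMap ℝ ℂ) * U = U * (stdJ k).map (algebraMap ℝ ℂ) := by
    have h1 : Complex.I • (D.map (algebraMap ℝ ℂ) * U) =
        Complex.I • (U * (stdJ k).map (algebraMap ℝ ℂ)) := by
      rw [← Matrix.smul_mul, hUD, mul_assoc, hU1, mul_one, Matrix.mul_smul]
    exact smul_right_injective _ Complex.I_ne_zero h1
  -- The columns of `T` are orthogonal `i`-eigenvectors of the standard structure; `U` carries them
  -- to those of `D`.
  let T : Matrix (Fin k × Fin 2) (Fin k) ℂ :=
    Matrix.of fun p a => if p.1 = a then ![1, -Complex.I] p.2 else 0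
  have hJT : (stdJ k).map (algebraMap ℝ ℂ) * T = Complex.I • T := by
    ext ⟨a, s⟩ b
    simp only [T, mul_apply, Fintype.sum_prod_type, Fin.sum_univ_two, of_apply, stdJ, rho,
      map_apply, Matrix.smul_apply, one_apply]
    by_cases hab : a = b
    · subst hab
      fin_cases s <;> simp [Finset.sum_add_distrib]
    · fin_cases s <;> simp [hab, Finset.sum_add_distrib]
  have hTT : Tᴴ * T = (2 : ℂ) • 1 := by
    ext a b
    simp only [T, mul_apply, Fintype.sum_prod_type, Fin.sum_univ_two, of_apply,
      conjTranspose_apply, Matrix.smul_apply, one_apply]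
    by_cases hab : a = b
    · subst hab
      simp [Finset.sum_add_distrib]; norm_num
    · simp [hab, Ne.symm hab, Finset.sum_add_distrib]
  set V := U * T with hV
  have hDV : D.map (algebraMap ℝ ℂ) * V = Complex.I • V := by
    rw [hV, ← Matrix.mul_assoc, hDU, Matrix.mul_assoc, hJT, Matrix.mul_smul]
  have hVV : Vᴴ * V = (2 : ℂ) • 1 := by
    rw [hV, conjTranspose_mul, Matrix.mul_assoc, ← Matrix.mul_assoc Uᴴ, ← star_eq_conjTranspose U,
      hU1, Matrix.one_mul, hTT]
  -- By skewness, `Vᵀ D V` equals both `i Vᵀ V` and `-i Vᵀ V`.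
  have hVt : Vᵀ * V = 0 := by
    have h1 : Vᵀ * (D.map (algebraMap ℝ ℂ) * V) = Complex.I • (Vᵀ * V) := by
      rw [hDV, Matrix.mul_smul]
    have h2 : (D.map (algebraMap ℝ ℂ) * V)ᵀ * V = Complex.I • (Vᵀ * V) := by
      rw [hDV, transpose_smul, Matrix.smul_mul]
    have h3 : (D.map (algebraMap ℝ ℂ))ᵀ = -D.map (algebraMap ℝ ℂ) := by
      ext i j
      have := congrFun (congrFun hs i) j
      simp only [transpose_apply, Matrix.neg_apply] at this
      simp [this]
    rw [transpose_mul, h3, Matrix.mul_neg, Matrix.neg_mul, Matrix.mul_assoc, h1] at h2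
    have h4 : (2 * Complex.I) • (Vᵀ * V) = 0 := by
      rw [mul_smul, two_smul]
      nth_rewrite 1 [← h2]
      simp
    exact (smul_eq_zero.mp h4).resolve_left (by simp)
  -- The real parts and the negated imaginary parts of the columns of `V`. The relations `Vᴴ V = 2`
  -- and `Vᵀ V = 0` together say that these are orthonormal; `D V = i V`, with the sign chosen here,
  -- says that `D` acts on them as `stdJ` does.
  let P : Matrix (Fin k × Fin 2) (Fin k × Fin 2) ℝ :=
    Matrix.of fun p q => ![(V p q.1).re, -(V p q.1).im] q.2
  have hP : Pᵀ * P = 1 := by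
    have g1 : ∀ a b, ∑ p, ((V p a).re * (V p b).re + (V p a).im * (V p b).im) =
        if a = b then 2 else 0 := by
      intro a b
      have := congrArg Complex.re (congrFun (congrFun hVV a) b)
      simpa [mul_apply, Complex.re_sum, one_apply, apply_ite Complex.re] using this
    have g2 : ∀ a b, ∑ p, ((V p a).re * (V p b).im - (V p a).im * (V p b).re) = 0 := by
      intro a b
      have := congrArg Complex.im (congrFun (congrFun hVV a) b)
      simpa [mul_apply, Complex.im_sum, one_apply, apply_ite Complex.im, sub_eq_add_neg] using this
    have g3 : ∀ a b, ∑ p, ((V p a).re * (V p b).re - (V p a).im * (V p b).im) = 0 := by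
      intro a b
      have := congrArg Complex.re (congrFun (congrFun hVt a) b)
      simpa [mul_apply, Complex.re_sum, -Finset.sum_sub_distrib] using this
    have g4 : ∀ a b, ∑ p, ((V p a).re * (V p b).im + (V p a).im * (V p b).re) = 0 := by
      intro a b
      have := congrArg Complex.im (congrFun (congrFun hVt a) b)
      simpa [mul_apply, Complex.im_sum] using this
    simp only [Finset.sum_add_distrib, Finset.sum_sub_distrib] at g1 g2 g3 g4
    ext ⟨a, s⟩ ⟨b, t⟩
    have e1 := g1 a b
    have e2 := g2 a b
    have e3 := g3 a b
    have e4 := g4 a b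
    by_cases hab : a = b
    · subst hab
      rw [if_pos rfl] at e1
      fin_cases s <;> fin_cases t <;> simp [P, mul_apply, one_apply] <;> linarith
    · rw [if_neg hab] at e1
      fin_cases s <;> fin_cases t <;> simp [P, mul_apply, one_apply, hab] <;> linarith
  have hDP : D * P = P * stdJ k := by
    have g1 : ∀ p a, ∑ q, D p q * (V q a).re = -(V p a).im := by
      intro p a
      have := congrArg Complex.re (congrFun (congrFun hDV p) a)
      simpa [mul_apply, Complex.re_sum] using this
    have g2 : ∀ p a, ∑ q, D p q * (V q a).im = (V p a).re := by
      intro p a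
      have := congrArg Complex.im (congrFun (congrFun hDV p) a)
      simpa [mul_apply, Complex.im_sum] using this
    ext p ⟨a, s⟩
    rw [mul_apply, mul_apply, Fintype.sum_prod_type (f := fun j => P p j * _)]
    simp only [Fin.sum_univ_two, P, of_apply, stdJ, rho, Matrix.smul_apply, one_apply]
    fin_cases s <;> simp [g1, g2, apply_ite Complex.im, apply_ite Complex.re]
  have hPP : P * Pᵀ = 1 := mul_eq_one_comm.mp hP
  exact ⟨P, mem_orthogonalGroup_iff_mul_transpose.mpr hPP, by
    rw [← hDP, mul_assoc, hPP, mul_one]⟩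

end Skew

/-! ### The half-angle exponentials -/

/-- The square root `e^{iθ/2}` of `e^{iθ}`. -/
def halfExp (θ : ℝ) : ℂ := Complex.exp (Complex.I * ((θ / 2 : ℝ) : ℂ))

lemma halfExp_re (θ : ℝ) : (halfExp θ).re = Real.cos (θ / 2) := by
  rw [halfExp, mul_comm, Complex.exp_ofReal_mul_I_re]

lemma halfExp_im (θ : ℝ) : (halfExp θ).im = Real.sin (θ / 2) := by
  rw [halfExp, mul_comm, Complex.exp_ofReal_mul_I_im]

lemma halfExp_sq (θ : ℝ) : halfExp θ * halfExp θ = Complex.exp (Complex.I * (θ : ℂ)) := by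
  rw [halfExp, ← Complex.exp_add]; congr 1; push_cast; ring

lemma halfExp_star_mul (θ : ℝ) : star (halfExp θ) * halfExp θ = 1 := by
  apply Complex.ext
  · simp [halfExp_re, halfExp_im]; nlinarith [Real.sin_sq_add_cos_sq (θ / 2)]
  · simp [halfExp_re, halfExp_im]; ring

lemma exp_neg_half (θ : ℝ) :
    Complex.exp (-(Complex.I * ((θ / 2 : ℝ) : ℂ))) = star (halfExp θ) := by
  simp [halfExp, ← Complex.exp_conj, map_ofNat]

/-! ### The strata of orthogonal square roots -/

section Strata

variable {n r h k : ℕ} {m : Fin r → ℕ} (hn : h + ((∑ j, m j * 2) + k * 2) = n) (θ : Fin r → ℝ)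

lemma rjs_eq : rjs hn θ =
    blockSum hn 1 (fun j => rho ((halfExp (θ j) * halfExp (θ j)) • 1)) (-1) := by
  rw [rjs]
  congr 1
  ext j : 1
  rw [rotBlocks_eq_rho, halfExp_sq, smul_one_eq_diagonal]

lemma exp_half_sub_pi (t : ℝ) :
    Complex.exp (Complex.I * ((t / 2 - Real.pi : ℝ) : ℂ)) = -halfExp t := by
  rw [halfExp, Complex.ofReal_sub, mul_sub, mul_comm Complex.I (Real.pi : ℂ),
    Complex.exp_sub_pi_mul_I]

lemma exp_neg_half_sub_pi (t : ℝ) :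
    Complex.exp (-(Complex.I * ((t / 2 - Real.pi : ℝ) : ℂ))) = -star (halfExp t) := by
  rw [← exp_neg_half, Complex.ofReal_sub, mul_sub, neg_sub, mul_comm Complex.I (Real.pi : ℂ),
    sub_eq_add_neg, add_comm, Complex.exp_add_pi_mul_I]

/-- As `e^{i(θ/2 - π)} = -e^{iθ/2}`, the auxiliary form is assembled from diagonal involutions: it
is the base point of the orbit. -/
lemma rja_eq (u : ℕ) (μ : Fin r → ℕ) : rja hn θ u μ =
    blockSum hn (diagonal fun i => if i.val < u then 1 else -1)
      (fun j => rho (halfExp (θ j) • diagonal fun a => if a.val < μ j then 1 else -1))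
      (stdJ k) := by
  rw [rja]
  congr 1
  · ext j : 1
    rw [rotBlocks_eq_rho]
    congr 1
    rw [← diagonal_smul]
    congr 1
    ext a
    by_cases ha : a.val < μ j
    · simp [ha, halfExp]
    · simp only [ha, if_false, exp_half_sub_pi, Pi.smul_apply, smul_eq_mul, mul_neg, mul_one]
  · rw [rotBlocks_eq_rho, stdJ, smul_one_eq_diagonal]
    congr 2
    ext a
    have : Complex.I * ((Real.pi / 2 : ℝ) : ℂ) = (Real.pi : ℂ) / 2 * Complex.I := by
      push_cast; ring
    rw [this, Complex.exp_pi_div_two_mul_I]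

lemma eigMult_conj {C : Matrix (Fin n) (Fin n) ℝ} (hC : C ∈ Matrix.orthogonalGroup (Fin n) ℝ)
    (Y : Matrix (Fin n) (Fin n) ℝ) : eigMult (C * Y * Cᵀ) = eigMult Y := by
  ext z
  rw [eigMult, eigMult, charpoly_map, charpoly_map,
    charpoly_conj C Cᵀ Y (mem_orthogonalGroup_iff_transpose_mul.mp hC)]

lemma mem_OSR_conj {C M Y : Matrix (Fin n) (Fin n) ℝ}
    (hC : C ∈ Matrix.orthogonalGroup (Fin n) ℝ) (hY : Y ∈ OSR M) :
    C * Y * Cᵀ ∈ OSR (C * M * Cᵀ) := by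
  refine ⟨mul_mem_orthogonalGroup (mul_mem_orthogonalGroup hC hY.1)
    (transpose_mem_orthogonalGroup hC), ?_⟩
  have h1 := mem_orthogonalGroup_iff_transpose_mul.mp hC
  calc C * Y * Cᵀ * (C * Y * Cᵀ) = C * Y * (Cᵀ * C) * Y * Cᵀ := by simp only [mul_assoc]
    _ = C * (Y * Y) * Cᵀ := by rw [h1]; simp only [mul_assoc, mul_one]
    _ = _ := by rw [hY.2]

lemma mem_OSRStratum_conj {C M Y : Matrix (Fin n) (Fin n) ℝ} {u : ℕ} {μ : Fin r → ℕ}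
    (hC : C ∈ Matrix.orthogonalGroup (Fin n) ℝ) (hY : Y ∈ OSRStratum M h m k θ u μ) :
    C * Y * Cᵀ ∈ OSRStratum (C * M * Cᵀ) h m k θ u μ := by
  refine ⟨mem_OSR_conj hC hY.1, ?_⟩
  rw [eigMult_conj hC]
  exact hY.2

lemma OSRStratum_eq_image {C J : Matrix (Fin n) (Fin n) ℝ} {u : ℕ} {μ : Fin r → ℕ}
    (hC : C ∈ Matrix.orthogonalGroup (Fin n) ℝ) :
    OSRStratum (C * J * Cᵀ) h m k θ u μ = congruence C '' OSRStratum J h m k θ u μ := by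
  have h1 := mem_orthogonalGroup_iff_transpose_mul.mp hC
  have h2 := mem_orthogonalGroup_iff_mul_transpose.mp hC
  ext Y
  constructor
  · intro hY
    refine ⟨Cᵀ * Y * Cᵀᵀ, ?_, ?_⟩
    · have := mem_OSRStratum_conj θ (transpose_mem_orthogonalGroup hC) hY
      have e : Cᵀ * (C * J * Cᵀ) * Cᵀᵀ = J := by
        calc Cᵀ * (C * J * Cᵀ) * Cᵀᵀ = (Cᵀ * C) * J * (Cᵀ * C) := by
              simp only [mul_assoc, transpose_transpose]
          _ = J := by rw [h1, one_mul, mul_one]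
      rwa [e] at this
    · calc C * (Cᵀ * Y * Cᵀᵀ) * Cᵀ = (C * Cᵀ) * Y * (C * Cᵀ) := by
            simp only [mul_assoc, transpose_transpose]
        _ = Y := by rw [h2, one_mul, mul_one]
  · rintro ⟨X, hX, rfl⟩
    exact mem_OSRStratum_conj θ hC hX

variable {θ}

lemma block_mem_OSR {A : Matrix (Fin h) (Fin h) ℝ} {a : ℕ} (hA : HasSig A a)
    {Z : ∀ j, Matrix (Fin (m j)) (Fin (m j)) ℂ} {q : Fin r → ℕ} (hZ : ∀ j, HasSig (Z j) (q j))
    {D : Matrix (Fin k × Fin 2) (Fin k × Fin 2) ℝ}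
    (hD : D ∈ Matrix.orthogonalGroup (Fin k × Fin 2) ℝ) (hs : Dᵀ = -D) :
    blockSum hn A (fun j => rho (halfExp (θ j) • Z j)) D ∈ OSR (rjs hn θ) := by
  refine ⟨?_, ?_⟩
  · rw [blockSum_mem_orthogonalGroup_iff]
    refine ⟨mem_orthogonalGroup_iff_mul_transpose.mp hA.mem_unitary, fun j => ?_,
      mem_orthogonalGroup_iff_mul_transpose.mp hD⟩
    rw [rho_orthogonal_iff, Matrix.mem_unitaryGroup_iff, star_smul, smul_mul_smul_comm,
      Matrix.mem_unitaryGroup_iff.mp (hZ j).mem_unitary, mul_comm, halfExp_star_mul, one_smul]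
  · rw [blockSum_mul, rjs_eq, hA.sq, skew_sq hD hs]
    congr 1
    ext j : 1
    rw [← rho_mul, smul_mul_smul_comm, (hZ j).sq]

/-- Commuting with `J` and `Jᵀ` forces the block form; inside each block, orthogonality and the
equation for the square force (skew-)Hermitian symmetry. -/
lemma exists_blocks_of_mem_OSR (hθ : StrictMono θ) (hθ0 : ∀ j, 0 < θ j)
    (hθπ : ∀ j, θ j < Real.pi) {Y : Matrix (Fin n) (Fin n) ℝ} (hY : Y ∈ OSR (rjs hn θ)) :
    ∃ (A : Matrix (Fin h) (Fin h) ℝ) (a : ℕ) (Z : ∀ j, Matrix (Fin (m j)) (Fin (m j)) ℂ)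
      (q : Fin r → ℕ) (D : Matrix (Fin k × Fin 2) (Fin k × Fin 2) ℝ),
      HasSig A a ∧ (∀ j, HasSig (Z j) (q j)) ∧ D ∈ Matrix.orthogonalGroup (Fin k × Fin 2) ℝ ∧
      Dᵀ = -D ∧ Y = blockSum hn A (fun j => rho (halfExp (θ j) • Z j)) D := by
  obtain ⟨hYo, hY2⟩ := hY
  have hYJ : Y * rjs hn θ = rjs hn θ * Y := by rw [← hY2, mul_assoc]
  have hYJt := commute_transpose_of_orthogonal hYo hYJ
  let c : Fin r → ℝ := fun j => Real.cos (θ j)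
  have hre : ∀ j, (halfExp (θ j) * halfExp (θ j)).re = c j := fun j => by
    rw [halfExp_sq, mul_comm, Complex.exp_ofReal_mul_I_re]
  have him : ∀ j, (halfExp (θ j) * halfExp (θ j)).im = Real.sin (θ j) := fun j => by
    rw [halfExp_sq, mul_comm, Complex.exp_ofReal_mul_I_im]
  -- Adding the transpose cancels the sines, so every block becomes scalar.
  have hsum : rjs hn θ + (rjs hn θ)ᵀ =
      (2 : ℝ) • blockSum (m := m) hn 1 (fun j => c j • 1) (-1) := by
    rw [two_smul, rjs_eq, blockSum_transpose, blockSum_add, blockSum_add, blockSum_inj]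
    refine ⟨by simp, fun j => ?_, by simp⟩
    ext ⟨a, s⟩ ⟨b, t⟩
    by_cases hab : a = b
    · subst hab
      fin_cases s <;> fin_cases t <;> simp [rho, -Complex.mul_re, -Complex.mul_im, hre]
    · fin_cases s <;> fin_cases t <;> simp [rho, hab, Ne.symm hab]
  have hcomm : Y * blockSum (m := m) hn 1 (fun j => c j • 1) (-1) =
      blockSum hn 1 (fun j => c j • 1) (-1) * Y := by
    have h1 : Y * (rjs hn θ + (rjs hn θ)ᵀ) = (rjs hn θ + (rjs hn θ)ᵀ) * Y := by
      rw [mul_add, add_mul, hYJ, hYJt]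
    rw [hsum, Matrix.mul_smul, Matrix.smul_mul] at h1
    exact smul_right_injective _ (two_ne_zero (α := ℝ)) h1
  have hmem : ∀ j, θ j ∈ Set.Icc 0 Real.pi := fun j => ⟨(hθ0 j).le, (hθπ j).le⟩
  have hinj := Real.injOn_cos
  -- The scalars are distinct by injectivity of the cosine on `[0, π]`; the scalars `1` and `-1` are
  -- the cosines of `0` and `π`.
  obtain ⟨A, B, D, rfl⟩ := exists_blockSum_of_commute hn (c := c)
    (fun i j hij => hθ.injective (hinj (hmem i) (hmem j) hij))
    (fun j hj => (hθ0 j).ne' (hinj (hmem j) ⟨le_rfl, Real.pi_pos.le⟩ (by simpa [c] using hj)))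
    (fun j hj => (hθπ j).ne (hinj (hmem j) ⟨Real.pi_pos.le, le_rfl⟩ (by simpa [c] using hj)))
    hcomm
  rw [rjs_eq, blockSum_mul, blockSum_mul, blockSum_inj] at hYJ
  rw [rjs_eq, blockSum_mul, blockSum_inj] at hY2
  rw [blockSum_mem_orthogonalGroup_iff] at hYo
  obtain ⟨hA2, hB2, hD2⟩ := hY2
  obtain ⟨hAo, hBo, hDo⟩ := hYo
  choose W hW using fun j => exists_rho_of_commute
    (by rw [him]; exact (Real.sin_pos_of_pos_of_lt_pi (hθ0 j) (hθπ j)).ne') (hYJ.2.1 j)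
  -- Uniqueness of inverses: applied with `Q` the adjoint of `P`, it makes a unitary involution
  -- Hermitian.
  have eq_of_mul : ∀ {ι : Type} {R : Type} [Fintype ι] [DecidableEq ι] [CommRing R]
      {P Q : Matrix ι ι R}, P * P = 1 → P * Q = 1 → Q = P := fun {_ _} _ _ _ {P Q} h1 h2 => by
    calc Q = (P * P) * Q := by rw [h1, one_mul]
      _ = P := by rw [mul_assoc, h2, mul_one]
  have hAs : A.IsHermitian := eq_of_mul hA2 hAo
  let Z : ∀ j, Matrix (Fin (m j)) (Fin (m j)) ℂ := fun j => star (halfExp (θ j)) • W j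
  have hWZ : ∀ j, W j = halfExp (θ j) • Z j := fun j => by
    simp only [Z]
    rw [smul_smul, mul_comm, halfExp_star_mul, one_smul]
  have hZ2 : ∀ j, Z j * Z j = 1 := fun j => by
    have h1 := hB2 j
    rw [hW, ← rho_mul] at h1
    simp only [Z]
    rw [smul_mul_smul_comm, rho_injective h1, smul_smul, mul_mul_mul_comm, halfExp_star_mul,
      one_mul, one_smul]
  have hZu : ∀ j, Z j * star (Z j) = 1 := fun j => by
    have h1 := hBo j
    rw [hW, rho_orthogonal_iff, Matrix.mem_unitaryGroup_iff] at h1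
    simp only [Z]
    rw [star_smul, smul_mul_smul_comm, h1, star_star, halfExp_star_mul, one_smul]
  have hZh : ∀ j, (Z j).IsHermitian := fun j => eq_of_mul (hZ2 j) (hZu j)
  obtain ⟨a, ha⟩ := exists_hasSig hAs hA2
  choose q hq using fun j => exists_hasSig (hZh j) (hZ2 j)
  refine ⟨A, a, Z, q, D, ha, hq, mem_orthogonalGroup_iff_mul_transpose.mpr hDo, ?_, ?_⟩
  · have hD3 : D * (-Dᵀ) = -1 := by rw [mul_neg, hDo]
    calc Dᵀ = (-(D * D)) * Dᵀ := by rw [hD2, neg_neg, one_mul]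
      _ = D * (-Dᵀ) * D * (D * Dᵀ) := by
          rw [hD3, hDo, mul_one]
          calc -(D * D) * Dᵀ = -D * (D * Dᵀ) := by simp only [neg_mul, mul_assoc]
            _ = -1 * D := by rw [hDo, mul_one, neg_one_mul]
      _ = -D := by rw [hDo, hD3, mul_one, neg_one_mul]
  · congr 1
    ext j : 1
    rw [hW, ← hWZ]

/-- Each block has a characteristic polynomial that is a product of known linear factors, a block
`rho` contributing also the conjugate ones. Coincidences among the roots are allowed here, whence
the sum of indicator terms. -/
lemma eigMult_blockSum {A : Matrix (Fin h) (Fin h) ℝ} {a : ℕ} (hA : HasSig A a)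
    {Z : ∀ j, Matrix (Fin (m j)) (Fin (m j)) ℂ} {q : Fin r → ℕ} (hZ : ∀ j, HasSig (Z j) (q j))
    {D : Matrix (Fin k × Fin 2) (Fin k × Fin 2) ℝ}
    (hD : D ∈ Matrix.orthogonalGroup (Fin k × Fin 2) ℝ) (hs : Dᵀ = -D) (s : Fin r → ℂ) (z : ℂ) :
    eigMult (blockSum hn A (fun j => rho (s j • Z j)) D) z =
      ((if z = 1 then a else 0) + if z = -1 then h - a else 0) +
      ((∑ j, (((if z = s j then q j else 0) + if z = -s j then m j - q j else 0) +
        ((if z = star (s j) then q j else 0) + if z = -star (s j) then m j - q j else 0))) +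
      ((if z = Complex.I then k else 0) + if z = -Complex.I then k else 0)) := by
  have e : ∀ (c : ℂ) (p q : ℕ), (X - C c) ^ p * (X + C c) ^ q =
    ((X - C c) ^ p * (X - C (-c)) ^ q : ℂ[X]) := by simp
  have hne : ∀ (c d : ℂ) (p q : ℕ), ((X - C c) ^ p * (X - C d) ^ q : ℂ[X]) ≠ 0 := fun c d p q =>
    mul_ne_zero (pow_ne_zero _ (X_sub_C_ne_zero c)) (pow_ne_zero _ (X_sub_C_ne_zero d))
  have h1 : (A.map (algebraMap ℝ ℂ)).charpoly = (X - C 1) ^ a * (X - C (-1)) ^ (h - a) := by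
    have := hA.map_ofReal.charpoly_smul 1
    rwa [one_smul, Fintype.card_fin, e] at this
  have h2 : ∀ j, ((rho (s j • Z j)).map (algebraMap ℝ ℂ)).charpoly =
      ((X - C (s j)) ^ q j * (X - C (-s j)) ^ (m j - q j)) *
      ((X - C (star (s j))) ^ q j * (X - C (-star (s j))) ^ (m j - q j)) := fun j => by
    rw [charpoly_rho_map, charpoly_map, (hZ j).charpoly_smul, Fintype.card_fin, ← e, ← e]
    simp
  rw [eigMult, charpoly_blockSum_map, h1, charpoly_skew_map hD hs]
  simp only [h2]
  have hne2 : ∀ j ∈ (Finset.univ : Finset (Fin r)),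
      ((X - C (s j)) ^ q j * (X - C (-s j)) ^ (m j - q j)) *
      ((X - C (star (s j))) ^ q j * (X - C (-star (s j))) ^ (m j - q j)) ≠ 0 :=
    fun j _ => mul_ne_zero (hne _ _ _ _) (hne _ _ _ _)
  have hne3 := mul_ne_zero (Finset.prod_ne_zero_iff.mpr hne2) (hne Complex.I (-Complex.I) k k)
  rw [rootMultiplicity_mul (mul_ne_zero (hne _ _ _ _) hne3), rootMultiplicity_mul hne3,
    rootMultiplicity_finset_prod _ _ hne2, rootMultiplicity_pm_pow, rootMultiplicity_pm_pow]
  congr 2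
  refine Finset.sum_congr rfl fun j hj => ?_
  rw [rootMultiplicity_mul (hne2 j hj), rootMultiplicity_pm_pow, rootMultiplicity_pm_pow]

/-- As `0 < θ_j/2 < π/2`, the numbers `e^{iθ_j/2}` lie in the open first quadrant and have distinct
real parts. So the listed eigenvalues are pairwise distinct and each multiplicity reads off a single
signature. -/
lemma block_mem_stratum_iff (hθ : StrictMono θ) (hθ0 : ∀ j, 0 < θ j)
    (hθπ : ∀ j, θ j < Real.pi) {A : Matrix (Fin h) (Fin h) ℝ} {a : ℕ} (hA : HasSig A a)
    {Z : ∀ j, Matrix (Fin (m j)) (Fin (m j)) ℂ} {q : Fin r → ℕ} (hZ : ∀ j, HasSig (Z j) (q j))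
    {D : Matrix (Fin k × Fin 2) (Fin k × Fin 2) ℝ}
    (hD : D ∈ Matrix.orthogonalGroup (Fin k × Fin 2) ℝ) (hs : Dᵀ = -D)
    {u : ℕ} {μ : Fin r → ℕ} :
    blockSum hn A (fun j => rho (halfExp (θ j) • Z j)) D ∈
      OSRStratum (rjs hn θ) h m k θ u μ ↔ a = u ∧ ∀ j, q j = μ j := by
  have hre : ∀ j, 0 < (halfExp (θ j)).re := fun j => by
    rw [halfExp_re]
    exact Real.cos_pos_of_mem_Ioo ⟨by linarith [hθ0 j, Real.pi_pos], by linarith [hθπ j]⟩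
  have him : ∀ j, 0 < (halfExp (θ j)).im := fun j => by
    rw [halfExp_im]
    exact Real.sin_pos_of_pos_of_lt_pi (by linarith [hθ0 j]) (by linarith [hθπ j, hθ0 j])
  have hinj : ∀ i j, (halfExp (θ i)).re = (halfExp (θ j)).re → i = j := fun i j hij => by
    rw [halfExp_re, halfExp_re] at hij
    have := Real.injOn_cos ⟨by linarith [hθ0 i], by linarith [hθπ i, hθ0 i]⟩
      ⟨by linarith [hθ0 j], by linarith [hθπ j, hθ0 j]⟩ hij
    exact hθ.injective (by linarith)
  have key := eigMult_blockSum hn hA hZ hD hs (fun j => halfExp (θ j))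
  have hE : ∀ j, Complex.exp (Complex.I * ((θ j / 2 : ℝ) : ℂ)) = halfExp (θ j) := fun j => rfl
  rw [OSRStratum, Set.mem_ofPred_eq]
  simp only [hE, exp_neg_half, exp_half_sub_pi, exp_neg_half_sub_pi]
  generalize hYdef : blockSum hn A (fun j => rho (halfExp (θ j) • Z j)) D = Y at key ⊢
  have hmem : Y ∈ OSR (rjs hn θ) := hYdef ▸ block_mem_OSR hn hA hZ hD hs
  generalize hsd : (fun j => halfExp (θ j)) = s
  have hs' : ∀ j, halfExp (θ j) = s j := fun j => congrFun hsd j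
  simp only [hs'] at key hre him hinj ⊢
  have v1 : eigMult Y 1 = a := by
    rw [key, Finset.sum_eq_zero]
    · norm_num [Complex.ext_iff]
    · intro j _
      have := him j
      simp [Complex.ext_iff, this.ne, this.ne']
  have v2 : eigMult Y (-1) = h - a := by
    rw [key, Finset.sum_eq_zero]
    · norm_num [Complex.ext_iff]
    · intro j _
      have := him j
      simp [Complex.ext_iff, this.ne, this.ne']
  have v3 : eigMult Y Complex.I = k := by
    rw [key, Finset.sum_eq_zero]
    · norm_num [Complex.ext_iff]
    · intro j _
      have := hre j
      simp [Complex.ext_iff, this.ne, this.ne']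
  have v4 : eigMult Y (-Complex.I) = k := by
    rw [key, Finset.sum_eq_zero]
    · norm_num [Complex.ext_iff]
    · intro j _
      have := hre j
      simp [Complex.ext_iff, this.ne]
  -- A point off both axes is none of `±1`, `±i`, and its real part excludes every block other than
  -- `j`.
  have aux : ∀ j z, z.re ≠ 0 → z.im ≠ 0 → (∀ i, i ≠ j → z.re ≠ (s i).re ∧ z.re ≠ -(s i).re) →
      eigMult Y z = ((if z = s j then q j else 0) + if z = -s j then m j - q j else 0) +
        ((if z = star (s j) then q j else 0) + if z = -star (s j) then m j - q j else 0) := by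
    intro j z h1 h2 h3
    rw [key, Finset.sum_eq_single j]
    · simp [Complex.ext_iff, h1, h2]
    · intro i _ hij
      have := h3 i hij
      simp [Complex.ext_iff, this.1, this.2]
    · simp
  have hne : ∀ j i, i ≠ j → (s j).re ≠ (s i).re := fun j i hij h => hij (hinj _ _ h.symm)
  have hne2 : ∀ j i, (s j).re ≠ -(s i).re := fun j i h => by linarith [hre i, hre j]
  have hne3 : ∀ j i, -(s j).re ≠ (s i).re := fun j i h => by linarith [hre i, hre j]
  have him2 : ∀ j, (s j).im ≠ -(s j).im := fun j h => by linarith [him j]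
  have him3 : ∀ j, -(s j).im ≠ (s j).im := fun j h => by linarith [him j]
  have w1 : ∀ j, eigMult Y (s j) = q j := fun j => by
    rw [aux j _ (hre j).ne' (him j).ne' fun i hi => ⟨hne j i hi, hne2 j i⟩]
    simp [Complex.ext_iff, hne2, him2]
  have w2 : ∀ j, eigMult Y (star (s j)) = q j := fun j => by
    rw [aux j _ (by simpa using (hre j).ne') (by simpa using (him j).ne')
      fun i hi => ⟨by simpa using hne j i hi, by simpa using hne2 j i⟩]
    simp [Complex.ext_iff, hne2, him3]
  have w3 : ∀ j, eigMult Y (-s j) = m j - q j := fun j => by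
    rw [aux j _ (by simpa using (hre j).ne') (by simpa using (him j).ne')
      fun i hi => ⟨by simpa using hne3 j i, by simpa using hne j i hi⟩]
    simp [Complex.ext_iff, hne3, him2, him3]
  have w4 : ∀ j, eigMult Y (-star (s j)) = m j - q j := fun j => by
    rw [aux j _ (by simpa using (hre j).ne') (by simpa using (him j).ne')
      fun i hi => ⟨by simpa using hne3 j i, by simpa using hne j i hi⟩]
    simp [Complex.ext_iff, hne3, him2, him3]
  simp only [v1, v2, v3, v4, w1, w2, w3, w4]
  constructor
  · rintro ⟨-, ha, -, hq, -⟩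
    exact ⟨ha, fun j => (hq j).1⟩
  · rintro ⟨rfl, hq⟩
    refine ⟨hmem, ?_⟩
    simp [hq]

/-- The stratum of the real Jordan form is a direct sum of sets of block matrices. -/
lemma OSRStratum_eq_modelSet (hθ : StrictMono θ) (hθ0 : ∀ j, 0 < θ j)
    (hθπ : ∀ j, θ j < Real.pi) {u : ℕ} {μ : Fin r → ℕ} :
    OSRStratum (rjs hn θ) h m k θ u μ = modelSet hn θ u μ := by
  ext Y
  constructor
  · intro hY
    obtain ⟨A, a, Z, q, D, hA, hZ, hD, hs, rfl⟩ :=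
      exists_blocks_of_mem_OSR hn hθ hθ0 hθπ hY.1
    obtain ⟨rfl, hq⟩ := (block_mem_stratum_iff hn hθ hθ0 hθπ hA hZ hD hs).mp hY
    exact ⟨A, ⟨hA.mem_unitary, (mem_hermSig_iff hA.mem_unitary).mpr hA⟩, Z, D, hD, fun j =>
      ⟨(hZ j).mem_unitary, (mem_hermSig_iff (hZ j).mem_unitary).mpr (hq j ▸ hZ j)⟩, hs, rfl⟩
  · rintro ⟨A, ⟨hA, hA'⟩, Z, D, hD, hZ, hs, rfl⟩
    exact (block_mem_stratum_iff hn hθ hθ0 hθπ ((mem_hermSig_iff hA).mp hA')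
      (fun j => (mem_hermSig_iff (hZ j).1).mp (hZ j).2) hD hs).mpr ⟨rfl, fun j => rfl⟩

lemma rja_mem_stratum (hθ : StrictMono θ) (hθ0 : ∀ j, 0 < θ j)
    (hθπ : ∀ j, θ j < Real.pi) {u : ℕ} (hu : u ≤ h) {μ : Fin r → ℕ} (hμ : ∀ j, μ j ≤ m j) :
    rja hn θ u μ ∈ OSRStratum (rjs hn θ) h m k θ u μ := by
  rw [rja_eq]
  exact (block_mem_stratum_iff hn hθ hθ0 hθπ (hasSig_diagonal _) (fun j => hasSig_diagonal _)
    stdJ_mem stdJ_transpose).mpr ⟨card_fin_lt hu, fun j => card_fin_lt (hμ j)⟩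

/-- The stratum of the real Jordan form is an orbit of the commutant. -/
lemma OSRStratum_rjs_eq_orbit (hθ : StrictMono θ) (hθ0 : ∀ j, 0 < θ j)
    (hθπ : ∀ j, θ j < Real.pi) {u : ℕ} (hu : u ≤ h) {μ : Fin r → ℕ} (hμ : ∀ j, μ j ≤ m j) :
    OSRStratum (rjs hn θ) h m k θ u μ =
      {Y | ∃ X ∈ orthComm (rjs hn θ),
        Y = (X : Matrix (Fin n) (Fin n) ℝ) * rja hn θ u μ * (X : Matrix (Fin n) (Fin n) ℝ)ᵀ} := by
  have hJ := rja_mem_stratum hn hθ hθ0 hθπ hu hμ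
  ext Y
  constructor
  · intro hY
    obtain ⟨A, a, Z, q, D, hA, hZ, hD, hs, rfl⟩ :=
      exists_blocks_of_mem_OSR hn hθ hθ0 hθπ hY.1
    obtain ⟨rfl, hq⟩ := (block_mem_stratum_iff hn hθ hθ0 hθπ hA hZ hD hs).mp hY
    have hA0 := hasSig_diagonal (𝕜 := ℝ) fun i : Fin h => i.val < a
    rw [card_fin_lt hu] at hA0
    obtain ⟨P, hP, hAP⟩ := hA.exists_conj hA0
    have hZ0 : ∀ j, HasSig (diagonal fun i : Fin (m j) => if i.val < μ j then (1 : ℂ) else -1)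
        (q j) := fun j => by
      have := hasSig_diagonal (𝕜 := ℂ) fun i : Fin (m j) => i.val < μ j
      rw [card_fin_lt (hμ j)] at this
      rw [hq j]
      exact this
    choose U hU hZU using fun j => (hZ j).exists_conj (hZ0 j)
    obtain ⟨O, hO, hDO⟩ := exists_conj_stdJ hD hs
    -- The conjugators are assembled blockwise. They commute with `rjs hn θ` because it is a real or
    -- complex scalar on each block and the middle conjugators are complex.
    have hX : blockSum hn P (fun j => rho (U j)) O ∈ Matrix.orthogonalGroup (Fin n) ℝ := by
      rw [blockSum_mem_orthogonalGroup_iff]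
      exact ⟨mem_orthogonalGroup_iff_mul_transpose.mp hP, fun j => rho_orthogonal_iff.mpr (hU j),
        mem_orthogonalGroup_iff_mul_transpose.mp hO⟩
    refine ⟨⟨_, hX⟩, ?_, ?_⟩
    · change rjs hn θ * blockSum hn P (fun j => rho (U j)) O =
        blockSum hn P (fun j => rho (U j)) O * rjs hn θ
      rw [rjs_eq, blockSum_mul, blockSum_mul, blockSum_inj]
      refine ⟨by rw [one_mul, mul_one], fun j => ?_, by simp⟩
      rw [← rho_mul, ← rho_mul, Matrix.smul_mul, Matrix.mul_smul, one_mul, mul_one]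
    · change _ = blockSum hn P (fun j => rho (U j)) O * rja hn θ a μ *
        (blockSum hn P (fun j => rho (U j)) O)ᵀ
      rw [rja_eq, blockSum_transpose, blockSum_mul, blockSum_mul, blockSum_inj]
      refine ⟨hAP, fun j => ?_, hDO⟩
      rw [← rho_conjTranspose, ← rho_mul, ← rho_mul, Matrix.mul_smul, Matrix.smul_mul]
      congr 2
      exact hZU j
  · rintro ⟨X, hX, rfl⟩
    have h1 := mem_OSRStratum_conj θ X.2 hJ
    have h2 : (X : Matrix (Fin n) (Fin n) ℝ) * rjs hn θ * (X : Matrix (Fin n) (Fin n) ℝ)ᵀ =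
        rjs hn θ := by
      have h3 : rjs hn θ * (X : Matrix (Fin n) (Fin n) ℝ) = X * rjs hn θ := hX
      rw [← h3, mul_assoc, mem_orthogonalGroup_iff_mul_transpose.mp X.2, mul_one]
    rwa [h2] at h1

lemma OSRStratum_eq_orbit (hθ : StrictMono θ) (hθ0 : ∀ j, 0 < θ j)
    (hθπ : ∀ j, θ j < Real.pi) {C : Matrix (Fin n) (Fin n) ℝ}
    (hC : C ∈ Matrix.orthogonalGroup (Fin n) ℝ) {u : ℕ} (hu : u ≤ h) {μ : Fin r → ℕ}
    (hμ : ∀ j, μ j ≤ m j) :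
    OSRStratum (C * rjs hn θ * Cᵀ) h m k θ u μ =
      {Y | ∃ X ∈ orthComm (rjs hn θ),
        Y = C * (X : Matrix (Fin n) (Fin n) ℝ) * rja hn θ u μ *
          (X : Matrix (Fin n) (Fin n) ℝ)ᵀ * Cᵀ} := by
  rw [OSRStratum_eq_image θ hC, OSRStratum_rjs_eq_orbit hn hθ hθ0 hθπ hu hμ]
  ext Y
  constructor
  · rintro ⟨_, ⟨X, hX, rfl⟩, rfl⟩
    exact ⟨X, hX, by simp only [congruence, mul_assoc]⟩
  · rintro ⟨X, hX, rfl⟩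
    exact ⟨_, ⟨X, hX, rfl⟩, by simp only [congruence, mul_assoc]⟩

/-- The auxiliary form squares to the Jordan form, and whatever commutes with a matrix commutes with
its square. -/
lemma orthComm_rja_le (hθ : StrictMono θ) (hθ0 : ∀ j, 0 < θ j)
    (hθπ : ∀ j, θ j < Real.pi) {u : ℕ} (hu : u ≤ h) {μ : Fin r → ℕ} (hμ : ∀ j, μ j ≤ m j) :
    orthComm (rja hn θ u μ) ≤ orthComm (rjs hn θ) := by
  intro X hX
  have hX' : rja hn θ u μ * (X : Matrix (Fin n) (Fin n) ℝ) = X * rja hn θ u μ := hX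
  change rjs hn θ * (X : Matrix (Fin n) (Fin n) ℝ) = X * rjs hn θ
  rw [← (rja_mem_stratum hn hθ hθ0 hθπ hu hμ).1.2, mul_assoc, hX', ← mul_assoc, hX', mul_assoc]

end Strata

end OrthRoots
end

/-! ### Geometry: slice charts, Cayley transform and the homogeneous space. -/

noncomputable section

namespace OrthRoots

open Topology

/-! ### Extending linear maps to isomorphisms -/

section Linear

variable {E E' F : Type*} [NormedAddCommGroup E] [NormedSpace ℝ E] [FiniteDimensional ℝ E]
  [NormedAddCommGroup E'] [NormedSpace ℝ E']
  [NormedAddCommGroup F] [NormedSpace ℝ F] [FiniteDimensional ℝ F]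

/-- A complement of the range is identified with `F` by dimension. This brings an inclusion that is
linear in charts to the immersion normal form `z ↦ (z, 0)`. -/
lemma exists_equiv_extending [FiniteDimensional ℝ E'] (j : E →ₗ[ℝ] E') (hj : Function.Injective j)
    (hF : Module.finrank ℝ E + Module.finrank ℝ F = Module.finrank ℝ E') :
    ∃ T : (E × F) ≃L[ℝ] E', ∀ e, T (e, 0) = j e := by
  obtain ⟨C, hC⟩ := Submodule.exists_isCompl (LinearMap.range j)
  have h1 := Submodule.finrank_add_eq_of_isCompl hC
  rw [LinearMap.finrank_range_of_inj hj] at h1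
  let e1 : F ≃ₗ[ℝ] C := LinearEquiv.ofFinrankEq F C (by omega)
  let T : (E × F) ≃ₗ[ℝ] E' := ((LinearEquiv.ofInjective j hj).prodCongr e1).trans
    (Submodule.prodEquivOfIsCompl _ _ hC)
  exact ⟨T.toContinuousLinearEquiv, fun e => by simp [T]⟩

/-- The dual statement for submersions: a projection onto the kernel supplies the missing
coordinate. -/
lemma exists_equiv_fst (g : E →ₗ[ℝ] E') (hg : Function.Surjective g)
    (hF : Module.finrank ℝ F + Module.finrank ℝ E' = Module.finrank ℝ E) :
    ∃ T : E ≃L[ℝ] (E' × F), ∀ e, (T e).1 = g e := by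
  obtain ⟨C, hC⟩ := Submodule.exists_isCompl (LinearMap.ker g)
  have h1 := LinearMap.finrank_range_add_finrank_ker g
  rw [LinearMap.range_eq_top.mpr hg, finrank_top] at h1
  let e1 : LinearMap.ker g ≃ₗ[ℝ] F := LinearEquiv.ofFinrankEq _ _ (by omega)
  let T : E ≃ₗ[ℝ] (E' × F) := (LinearMap.equivProdOfSurjectiveOfIsCompl g
    (Submodule.projectionOnto _ _ hC) (LinearMap.range_eq_top.mpr hg)
    (Submodule.range_projectionOnto hC)
    (by rw [Submodule.ker_projectionOnto]; exact hC)).trans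
    ((LinearEquiv.refl ℝ E').prodCongr e1)
  exact ⟨T.toContinuousLinearEquiv, fun e => rfl⟩

end Linear

/-! ### Submanifolds given by slice charts -/

section Slice

variable {V : Type} [NormedAddCommGroup V] [NormedSpace ℝ V]

/-- A family of smooth charts of `V`, one around each point of the image of the topological
embedding `ι : X → V`, flattening this image to `d`-dimensional linear subspaces. -/
structure SliceAtlas {X : Type} [TopologicalSpace X] (ι : X → V) (d : ℕ) where
  isEmbedding : IsEmbedding ι
  /-- the charts of `V` -/
  Φ : X → OpenPartialHomeomorph V V
  mem_source : ∀ x, ι x ∈ (Φ x).source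
  contDiffOn : ∀ x, ContDiffOn ℝ ∞ (Φ x) (Φ x).source
  contDiffOn_symm : ∀ x, ContDiffOn ℝ ∞ (Φ x).symm (Φ x).target
  /-- parametrizations of the subspaces -/
  i : X → (EuclideanSpace ℝ (Fin d) →L[ℝ] V)
  /-- left inverses of the parametrizations -/
  p : X → (V →L[ℝ] EuclideanSpace ℝ (Fin d))
  p_i : ∀ x v, p x (i x v) = v
  mem_range_iff : ∀ x, ∀ v ∈ (Φ x).source, v ∈ Set.range ι ↔ i x (p x (Φ x v)) = Φ x v

namespace SliceAtlas

variable {X Y : Type} [TopologicalSpace X] [TopologicalSpace Y] {ι : X → V} {d : ℕ}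
  (A : SliceAtlas ι d)

lemma i_p {x y : X} (hy : ι y ∈ (A.Φ x).source) :
    A.i x (A.p x (A.Φ x (ι y))) = A.Φ x (ι y) :=
  (A.mem_range_iff x _ hy).mp ⟨y, rfl⟩

lemma exists_of_mem_target {x : X} {z : EuclideanSpace ℝ (Fin d)}
    (hz : A.i x z ∈ (A.Φ x).target) : ∃ y, ι y = (A.Φ x).symm (A.i x z) := by
  have := (A.mem_range_iff x _ ((A.Φ x).map_target hz)).mpr
    (by rw [(A.Φ x).right_inv hz, A.p_i])
  exact this

open Classical in
/-- The inverse of the chart `SliceAtlas.chart`. -/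
def chartInv (x : X) (z : EuclideanSpace ℝ (Fin d)) : X :=
  -- The default `x` is never used on the chart's target.
  if h : ∃ y, ι y = (A.Φ x).symm (A.i x z) then h.choose else x

lemma ι_chartInv {x : X} {z : EuclideanSpace ℝ (Fin d)} (hz : A.i x z ∈ (A.Φ x).target) :
    ι (A.chartInv x z) = (A.Φ x).symm (A.i x z) := by
  have h := A.exists_of_mem_target hz
  rw [chartInv, dif_pos h]
  exact h.choose_spec

/-- The chart of `X` around `x` induced by the chart `Φ x` of `V`. -/
def chart (x : X) : OpenPartialHomeomorph X (EuclideanSpace ℝ (Fin d)) where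
  toFun y := A.p x (A.Φ x (ι y))
  invFun := A.chartInv x
  source := ι ⁻¹' (A.Φ x).source
  target := A.i x ⁻¹' (A.Φ x).target
  map_source' y hy := by
    rw [Set.mem_preimage, A.i_p hy]
    exact (A.Φ x).map_source hy
  map_target' z hz := by
    rw [Set.mem_preimage, A.ι_chartInv hz]
    exact (A.Φ x).map_target hz
  left_inv' y hy := by
    apply A.isEmbedding.injective
    rw [A.ι_chartInv, A.i_p hy, (A.Φ x).left_inv hy]
    rw [A.i_p hy]
    exact (A.Φ x).map_source hy
  right_inv' z hz := by
    rw [A.ι_chartInv hz, (A.Φ x).right_inv hz, A.p_i]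
  open_source := (A.Φ x).open_source.preimage A.isEmbedding.continuous
  open_target := (A.Φ x).open_target.preimage (A.i x).continuous
  continuousOn_toFun := (A.p x).continuous.comp_continuousOn
    ((A.Φ x).continuousOn.comp A.isEmbedding.continuous.continuousOn fun _ h => h)
  continuousOn_invFun := by
    rw [A.isEmbedding.continuousOn_iff]
    exact ((A.Φ x).symm.continuousOn.comp (A.i x).continuous.continuousOn fun _ h => h).congr
      fun z hz => A.ι_chartInv hz

/-- The atlas of induced charts. -/
abbrev chartedSpace : ChartedSpace (EuclideanSpace ℝ (Fin d)) X where
  atlas := Set.range A.chart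
  chartAt := A.chart
  mem_chart_source := A.mem_source
  chart_mem_atlas x := ⟨x, rfl⟩

/-- A transition map is an ambient transition map `Φ y ∘ (Φ x)⁻¹` between the linear maps `i x` and
`p y`. -/
lemma isManifold : @IsManifold ℝ _ _ _ _ _ _ (𝓡 d) ∞ X _ A.chartedSpace := by
  let := A.chartedSpace
  apply isManifold_of_contDiffOn
  rintro _ _ ⟨x, rfl⟩ ⟨y, rfl⟩
  simp only [modelWithCornersSelf_coe, modelWithCornersSelf_coe_symm, Function.id_comp,
    Function.comp_id, Set.range_id, Set.inter_univ, Set.preimage_id]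
  have h : ContDiffOn ℝ ∞ (fun z => A.p y (A.Φ y ((A.Φ x).symm (A.i x z))))
      ((A.chart x).symm ≫ₕ A.chart y).source := by
    refine (A.p y).contDiff.comp_contDiffOn ((A.contDiffOn y).comp
      ((A.contDiffOn_symm x).comp (A.i x).contDiff.contDiffOn fun z hz => hz.1) fun z hz => ?_)
    have h2 : ι (A.chartInv x z) ∈ (A.Φ y).source := hz.2
    rwa [A.ι_chartInv hz.1] at h2
  refine h.congr fun z hz => ?_
  change A.p y (A.Φ y (ι (A.chartInv x z))) = _
  rw [A.ι_chartInv hz.1]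

/-- The smooth structure defined by the induced charts. -/
def smoothStructure : SmoothStructure X := ⟨d, A.chartedSpace, A.isManifold⟩

lemma chart_mem_maximalAtlas (x : X) :
    letI := A.chartedSpace
    A.chart x ∈ IsManifold.maximalAtlas (𝓡 d) ∞ X := by
  let := A.chartedSpace
  have := A.isManifold
  exact IsManifold.chart_mem_maximalAtlas x

lemma i_injective (x : X) : Function.Injective (A.i x) :=
  Function.LeftInverse.injective (A.p_i x)

lemma embedsInSpace [FiniteDimensional ℝ V] : A.smoothStructure.EmbedsInSpace ι := by
  let := A.chartedSpace
  have := A.isManifold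
  change IsSmoothEmbedding (𝓡 d) 𝓘(ℝ, V) ∞ ι
  refine ⟨?_, A.isEmbedding⟩
  -- A point is needed to know `d ≤ dim V`, without which the truncated subtraction in the dimension
  -- of `F` would be wrong.
  by_cases hX : IsEmpty X
  · exact ⟨PUnit, inferInstance, inferInstance, fun x => (hX.false x).elim⟩
  obtain ⟨x₀⟩ := not_isEmpty_iff.mp hX
  have hle := LinearMap.finrank_le_finrank_of_injective (f := (A.i x₀).toLinearMap)
    (A.i_injective x₀)
  let F := EuclideanSpace ℝ (Fin (Module.finrank ℝ V - Module.finrank ℝ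
    (EuclideanSpace ℝ (Fin d))))
  have hF : Module.finrank ℝ (EuclideanSpace ℝ (Fin d)) + Module.finrank ℝ F =
      Module.finrank ℝ V := by
    rw [finrank_euclideanSpace_fin (n := Module.finrank ℝ V - _)]; omega
  refine ⟨F, inferInstance, inferInstance, fun x => ?_⟩
  obtain ⟨T, hT⟩ := exists_equiv_extending (A.i x).toLinearMap (A.i_injective x) hF
  refine IsImmersionAtOfComplement.mk_of_charts T (A.chart x) (A.Φ x) (A.mem_source x)
    (A.mem_source x) (A.chart_mem_maximalAtlas x) ?_ (fun y hy => hy) ?_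
  · exact (A.Φ x).mem_maximalAtlas_of_contMDiffOn (A.contDiffOn x).contMDiffOn
      (A.contDiffOn_symm x).contMDiffOn
  · intro z hz
    have hz' : A.i x z ∈ (A.Φ x).target := by
      have : z ∈ (A.chart x).target := by simpa using hz
      exact this
    change A.Φ x (ι (A.chartInv x z)) = T (z, 0)
    rw [A.ι_chartInv hz', (A.Φ x).right_inv hz', hT]
    rfl

lemma contMDiff_ι [FiniteDimensional ℝ V] :
    letI := A.chartedSpace
    ContMDiff (𝓡 d) 𝓘(ℝ, V) ∞ ι := by
  let := A.chartedSpace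
  have := A.isManifold
  exact IsSmoothEmbedding.contMDiff A.embedsInSpace

/-- A continuous map into `X` is smooth if its composition with `ι` is. -/
lemma contMDiff_of_comp {E H M : Type*} [NormedAddCommGroup E] [NormedSpace ℝ E]
    [TopologicalSpace H] {I : ModelWithCorners ℝ E H} [TopologicalSpace M] [ChartedSpace H M]
    {f : M → X} (hf : Continuous f) (h : ContMDiff I 𝓘(ℝ, V) ∞ (ι ∘ f)) :
    letI := A.chartedSpace
    ContMDiff I (𝓡 d) ∞ f := by
  let := A.chartedSpace
  intro z
  rw [contMDiffAt_iff_target]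
  refine ⟨hf.continuousAt, ?_⟩
  have h1 : ContDiffAt ℝ ∞ (fun v => A.p (f z) (A.Φ (f z) v)) (ι (f z)) :=
    (A.p (f z)).contDiff.contDiffAt.comp _ ((A.contDiffOn (f z)).contDiffAt
      ((A.Φ (f z)).open_source.mem_nhds (A.mem_source (f z))))
  exact ContMDiffAt.comp (g := fun v => A.p (f z) (A.Φ (f z) v)) (f := ι ∘ f) z h1.contMDiffAt (h z)

variable {κ : Y → V} {e : ℕ} (B : SliceAtlas κ e)

/-- Inclusions of nested slices are smooth embeddings. -/
lemma embedsIn [FiniteDimensional ℝ V] {f : X → Y} (hf : ∀ x, κ (f x) = ι x)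
    (hΦ : ∀ x, A.Φ x = B.Φ (f x)) (hi : ∀ x v, B.i (f x) (B.p (f x) (A.i x v)) = A.i x v) :
    A.smoothStructure.EmbedsIn B.smoothStructure f := by
  let := A.chartedSpace
  have := A.isManifold
  let := B.chartedSpace
  have := B.isManifold
  change IsSmoothEmbedding (𝓡 d) (𝓡 e) ∞ f
  have hfe : IsEmbedding f := by
    have : IsEmbedding (κ ∘ f) := by
      rw [show κ ∘ f = ι from funext hf]; exact A.isEmbedding
    exact (B.isEmbedding.of_comp_iff).mp this
  refine ⟨?_, hfe⟩
  by_cases hX : IsEmpty X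
  · exact ⟨PUnit, inferInstance, inferInstance, fun x => (hX.false x).elim⟩
  obtain ⟨x₀⟩ := not_isEmpty_iff.mp hX
  let j : X → (EuclideanSpace ℝ (Fin d) →ₗ[ℝ] EuclideanSpace ℝ (Fin e)) :=
    fun x => ((B.p (f x)).comp (A.i x) : _ →L[ℝ] _)
  have hj : ∀ x, Function.Injective (j x) := fun x v w hvw => by
    apply A.i_injective x
    rw [← hi x v, ← hi x w]
    exact congrArg _ hvw
  have hle := LinearMap.finrank_le_finrank_of_injective (hj x₀)
  rw [finrank_euclideanSpace_fin, finrank_euclideanSpace_fin] at hle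
  let F := EuclideanSpace ℝ (Fin (e - d))
  have hF : Module.finrank ℝ (EuclideanSpace ℝ (Fin d)) + Module.finrank ℝ F =
      Module.finrank ℝ (EuclideanSpace ℝ (Fin e)) := by
    simp only [F, finrank_euclideanSpace_fin]; omega
  refine ⟨F, inferInstance, inferInstance, fun x => ?_⟩
  obtain ⟨T, hT⟩ := exists_equiv_extending (j x) (hj x) hF
  refine IsImmersionAtOfComplement.mk_of_charts T (A.chart x) (B.chart (f x)) (A.mem_source x)
    (B.mem_source (f x)) (A.chart_mem_maximalAtlas x) (B.chart_mem_maximalAtlas (f x)) ?_ ?_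
  · intro y hy
    change κ (f y) ∈ (B.Φ (f x)).source
    rw [hf, ← hΦ]
    exact hy
  · intro z hz
    have hz' : A.i x z ∈ (A.Φ x).target := by
      have : z ∈ (A.chart x).target := by simpa using hz
      exact this
    change B.p (f x) (B.Φ (f x) (κ (f (A.chartInv x z)))) = T (z, 0)
    rw [hf, A.ι_chartInv hz', ← hΦ, (A.Φ x).right_inv hz', hT]
    rfl

end SliceAtlas

end Slice

/-! ### Submersions -/

/-- A map which is smooth in charts with surjective derivative is a submersion. -/
lemma isSubmersionAt_of_surjective {E E' F M N : Type*}
    [NormedAddCommGroup E] [NormedSpace ℝ E] [FiniteDimensional ℝ E]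
    [NormedAddCommGroup E'] [NormedSpace ℝ E']
    [NormedAddCommGroup F] [NormedSpace ℝ F] [FiniteDimensional ℝ F]
    [TopologicalSpace M] [ChartedSpace E M] [IsManifold 𝓘(ℝ, E) ∞ M]
    [TopologicalSpace N] [ChartedSpace E' N]
    (hF : Module.finrank ℝ F + Module.finrank ℝ E' = Module.finrank ℝ E)
    {f : M → N} {x : M} (hf : ContinuousAt f x)
    {φ : OpenPartialHomeomorph M E} (hφ : φ ∈ IsManifold.maximalAtlas 𝓘(ℝ, E) ∞ M)
    {ψ : OpenPartialHomeomorph N E'} (hψ : ψ ∈ IsManifold.maximalAtlas 𝓘(ℝ, E') ∞ N)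
    (hx : x ∈ φ.source) (hfx : f x ∈ ψ.source)
    {U : Set E} (hU : IsOpen U) (hxU : φ x ∈ U)
    {g : E → E'} (hg : ContDiffOn ℝ ∞ g U) (hgf : ∀ z ∈ U, ψ (f (φ.symm z)) = g z)
    {g' : E →L[ℝ] E'} (hg' : HasFDerivAt g g' (φ x)) (hs : Function.Surjective g') :
    IsSubmersionAtOfComplement F 𝓘(ℝ, E) 𝓘(ℝ, E') ∞ f x := by
  obtain ⟨T, hT⟩ := exists_equiv_fst (F := F) g'.toLinearMap hs hF
  have : CompleteSpace E := FiniteDimensional.complete ℝ E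
  -- `g` completed by a kernel coordinate is a local diffeomorphism; used as a chart, it makes `f` a
  -- linear projection.
  let H : E → E' × F := fun z => (g z, (T z).2)
  have hH : ContDiffOn ℝ ∞ H U :=
    hg.prodMk (contDiff_snd.comp T.contDiff).contDiffOn
  have hHa : ContDiffAt ℝ ∞ H (φ x) := hH.contDiffAt (hU.mem_nhds hxU)
  have hH' : HasFDerivAt H (T : E →L[ℝ] E' × F) (φ x) := by
    have h1 : HasFDerivAt (fun z => (T z).2)
        ((ContinuousLinearMap.snd ℝ E' F).comp (T : E →L[ℝ] E' × F)) (φ x) :=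
      ((ContinuousLinearMap.snd ℝ E' F).comp (T : E →L[ℝ] E' × F)).hasFDerivAt
    have h2 := hg'.prodMk h1
    convert h2 using 1
    ext z
    · exact hT z
    · rfl
  let Θ₀ := hHa.toOpenPartialHomeomorph H hH' (by simp)
  -- Restricting to the open set where the derivative is invertible makes the local inverse smooth
  -- on its whole domain, not just at the centre.
  let W : Set E := U ∩ fderiv ℝ H ⁻¹' Set.range ((↑) : (E ≃L[ℝ] E' × F) → E →L[ℝ] E' × F)
  have hW : IsOpen W := (hH.continuousOn_fderiv_of_isOpen hU (by simp)).isOpen_inter_preimage hU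
    (ContinuousLinearEquiv.isOpen)
  let Θ := Θ₀.restrOpen W hW
  have hΘW : ∀ z ∈ Θ.source, z ∈ W := fun z hz => hz.2
  have hΘ : ∀ z, Θ z = H z := fun z => rfl
  have hΘs : ContDiffOn ℝ ∞ Θ.symm Θ.target := by
    intro w hw
    have h1 := hΘW _ (Θ.map_target hw)
    obtain ⟨T', hT'⟩ := h1.2
    have h2 : ContDiffAt ℝ ∞ H (Θ.symm w) := hH.contDiffAt (hU.mem_nhds h1.1)
    have h3 : HasFDerivAt H (T' : E →L[ℝ] E' × F) (Θ.symm w) := by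
      rw [hT']
      exact (h2.differentiableAt (by simp)).hasFDerivAt
    exact (Θ.contDiffAt_symm hw h3 h2).contDiffWithinAt
  let κ : OpenPartialHomeomorph E E := Θ ≫ₕ T.symm.toHomeomorph.toOpenPartialHomeomorph
  have hκ : ContDiffOn ℝ ∞ κ κ.source :=
    T.symm.contDiff.comp_contDiffOn (hH.mono fun z hz => (hΘW z hz.1).1)
  have hκs : ContDiffOn ℝ ∞ κ.symm κ.target :=
    hΘs.comp T.contDiff.contDiffOn fun z hz => hz.2
  let φ' := φ ≫ₕ κ
  have hφ' : φ' ∈ IsManifold.maximalAtlas 𝓘(ℝ, E) ∞ M := by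
    apply φ'.mem_maximalAtlas_of_contMDiffOn
    · exact hκ.contMDiffOn.comp ((contMDiffOn_of_mem_maximalAtlas hφ).mono fun y hy => hy.1)
        fun y hy => hy.2
    · exact (contMDiffOn_symm_of_mem_maximalAtlas hφ).comp
        (hκs.contMDiffOn.mono fun y hy => hy.1) fun y hy => hy.2
  have hxs : φ x ∈ Θ.source :=
    ⟨hHa.mem_toOpenPartialHomeomorph_source hH' (by simp), hxU, T, hH'.fderiv.symm⟩
  refine IsSubmersionAtOfComplement.mk_of_continuousAt hf T φ' ψ ⟨hx, hxs, trivial⟩ hfx hφ' hψ ?_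
  intro z hz
  have hz' : z ∈ φ'.target := by simpa using hz
  have h1 : T z ∈ Θ.target := hz'.1.2
  have h2 : Θ.symm (T z) ∈ U := (hΘW _ (Θ.map_target h1)).1
  change ψ (f (φ.symm (Θ.symm (T z)))) = (T z).1
  rw [hgf _ h2]
  exact congrArg Prod.fst (Θ.right_inv h1)

namespace SliceAtlas

variable {V : Type} [NormedAddCommGroup V] [NormedSpace ℝ V]
  {X Y : Type} [TopologicalSpace X] [TopologicalSpace Y] {ι : X → V} {κ : Y → V} {d e : ℕ}

/-- A map between slices which is the restriction of a smooth map `P` of the ambient space is a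
submersion if its derivative, computed along curves, is surjective. -/
lemma submersesOnto (A : SliceAtlas ι d) (B : SliceAtlas κ e) {π : X → Y} (hπ : Continuous π)
    (hsurj : Function.Surjective π) {P : V → V} (hP : ContDiff ℝ ∞ P)
    (hPπ : ∀ x, κ (π x) = P (ι x))
    (hderiv : ∀ x w, ∃ v, HasDerivAt
      (fun t : ℝ => B.Φ (π x) (P ((A.Φ x).symm (A.i x (A.chart x x + t • v)))))
      (B.i (π x) w) 0) :
    A.smoothStructure.SubmersesOnto B.smoothStructure π := by
  let _ := A.chartedSpace
  have _ := A.isManifold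
  let _ := B.chartedSpace
  have _ := B.isManifold
  change Function.Surjective π ∧ IsSubmersion (𝓡 d) (𝓡 e) ∞ π
  refine ⟨hsurj, ?_⟩
  let g : X → EuclideanSpace ℝ (Fin d) → EuclideanSpace ℝ (Fin e) := fun x z =>
    B.p (π x) (B.Φ (π x) (P ((A.Φ x).symm (A.i x z))))
  let U : X → Set (EuclideanSpace ℝ (Fin d)) := fun x =>
    (A.chart x).target ∩ (fun z => P ((A.Φ x).symm (A.i x z))) ⁻¹' (B.Φ (π x)).source
  have hsm : ∀ x, ContDiffOn ℝ ∞ (fun z => P ((A.Φ x).symm (A.i x z))) (A.chart x).target :=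
    fun x => hP.comp_contDiffOn
      ((A.contDiffOn_symm x).comp (A.i x).contDiff.contDiffOn fun z hz => hz)
  have hU : ∀ x, IsOpen (U x) := fun x =>
    (hsm x).continuousOn.isOpen_inter_preimage (A.chart x).open_target (B.Φ (π x)).open_source
  have hxU : ∀ x, A.chart x x ∈ U x := fun x => by
    refine ⟨(A.chart x).map_source (A.mem_source x), ?_⟩
    change P ((A.Φ x).symm (A.i x (A.p x (A.Φ x (ι x))))) ∈ (B.Φ (π x)).source
    rw [A.i_p (A.mem_source x), (A.Φ x).left_inv (A.mem_source x), ← hPπ]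
    exact B.mem_source (π x)
  have hg : ∀ x, ContDiffOn ℝ ∞ (g x) (U x) := fun x =>
    (B.p (π x)).contDiff.comp_contDiffOn
      ((B.contDiffOn (π x)).comp ((hsm x).mono fun z hz => hz.1) fun z hz => hz.2)
  have hg' : ∀ x, HasFDerivAt (g x) (fderiv ℝ (g x) (A.chart x x)) (A.chart x x) := fun x =>
    (((hg x).contDiffAt ((hU x).mem_nhds (hxU x))).differentiableAt (by simp)).hasFDerivAt
  have hs : ∀ x, Function.Surjective (fderiv ℝ (g x) (A.chart x x)) := fun x w => by
    obtain ⟨v, hv⟩ := hderiv x w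
    refine ⟨v, ?_⟩
    have h1 : HasDerivAt (fun t : ℝ => g x (A.chart x x + t • v))
        (B.p (π x) (B.i (π x) w)) 0 := (B.p (π x)).hasFDerivAt.comp_hasDerivAt 0 hv
    have h2 : HasDerivAt (fun t : ℝ => A.chart x x + t • v) v 0 := by
      simpa using ((hasDerivAt_id (0 : ℝ)).smul_const v).const_add (A.chart x x)
    have h3 : HasFDerivAt (g x) (fderiv ℝ (g x) (A.chart x x))
        (A.chart x x + (0 : ℝ) • v) := by
      rw [zero_smul, add_zero]; exact hg' x
    rw [← B.p_i (π x) w]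
    have h4 := h3.comp_hasDerivAt (0 : ℝ) h2
    exact h4.unique h1
  by_cases hX : IsEmpty X
  · exact ⟨PUnit, inferInstance, inferInstance, fun x => (hX.false x).elim⟩
  obtain ⟨x₀⟩ := not_isEmpty_iff.mp hX
  have hle := LinearMap.finrank_le_finrank_of_surjective
    (f := (fderiv ℝ (g x₀) (A.chart x₀ x₀)).toLinearMap) (hs x₀)
  rw [finrank_euclideanSpace_fin, finrank_euclideanSpace_fin] at hle
  let F := EuclideanSpace ℝ (Fin (d - e))
  have hF : Module.finrank ℝ F + Module.finrank ℝ (EuclideanSpace ℝ (Fin e)) =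
      Module.finrank ℝ (EuclideanSpace ℝ (Fin d)) := by
    simp only [F, finrank_euclideanSpace_fin]; omega
  refine ⟨F, inferInstance, inferInstance, fun x => ?_⟩
  refine isSubmersionAt_of_surjective hF hπ.continuousAt (A.chart_mem_maximalAtlas x)
    (B.chart_mem_maximalAtlas (π x)) (A.mem_source x) (B.mem_source (π x)) (hU x) (hxU x)
    (hg x) (fun z hz => ?_) (hg' x) (hs x)
  change B.p (π x) (B.Φ (π x) (κ (π (A.chartInv x z)))) = _
  rw [hPπ, A.ι_chartInv hz.1]

/-- Homeomorphic slices with the same ambient image are diffeomorphic. -/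
lemma diffeomorphic [FiniteDimensional ℝ V] (A : SliceAtlas ι d) (B : SliceAtlas κ e)
    (h : X ≃ₜ Y) (hκ : ∀ x, κ (h x) = ι x) :
    A.smoothStructure.Diffeomorphic B.smoothStructure := by
  let _ := A.chartedSpace
  let _ := B.chartedSpace
  change Nonempty (X ≃ₘ⟮𝓡 d, 𝓡 e⟯ Y)
  refine ⟨⟨h.toEquiv, ?_, ?_⟩⟩
  · apply B.contMDiff_of_comp h.continuous
    rw [show κ ∘ h = ι from funext hκ]
    exact A.contMDiff_ι
  · apply A.contMDiff_of_comp h.symm.continuous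
    rw [show ι ∘ h.symm = κ from funext fun y => by rw [Function.comp, ← hκ, h.apply_symm_apply]]
    exact B.contMDiff_ι

end SliceAtlas

/-! ### The Cayley transform -/

section Cayley

section Ring

variable {R : Type*} [Ring R]

/-- The Cayley transform `(1 - a) (1 + a)⁻¹`. -/
def cay (a : R) : R := (1 - a) * Ring.inverse (1 + a)

lemma cay_mul {a : R} (h : IsUnit (1 + a)) : cay a * (1 + a) = 1 - a := by
  rw [cay, mul_assoc, Ring.inverse_mul_cancel _ h, mul_one]

lemma eq_cay {a c : R} (h : IsUnit (1 + a)) (hc : c * (1 + a) = 1 - a) : cay a = c :=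
  h.mul_left_injective ((cay_mul h).trans hc.symm)

/-- The Cayley transform respects intertwining relations. -/
lemma cay_intertwine {a a' b : R} (h : IsUnit (1 + a)) (h' : IsUnit (1 + a'))
    (hb : b * a = a' * b) : b * cay a = cay a' * b := by
  apply h.mul_left_injective
  change b * cay a * (1 + a) = cay a' * b * (1 + a)
  rw [mul_assoc, cay_mul h, mul_assoc, mul_add, hb, mul_one]
  have : b + a' * b = (1 + a') * b := by rw [add_mul, one_mul]
  rw [this, ← mul_assoc, cay_mul h', mul_sub, mul_one, hb, sub_mul, one_mul]

lemma mul_cay {a : R} (h : IsUnit (1 + a)) : (1 + a) * cay a = 1 - a := by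
  rw [add_mul, cay_intertwine h h rfl, one_mul, ← mul_one_add, cay_mul h]

lemma cay_mul_cay_neg {a : R} (h : IsUnit (1 + a)) (h' : IsUnit (1 - a)) :
    cay a * cay (-a) = 1 := by
  have h'' : IsUnit (1 + -a) := by rwa [← sub_eq_add_neg]
  apply h.mul_right_injective
  change (1 + a) * (cay a * cay (-a)) = (1 + a) * 1
  have h2 := mul_cay h''
  rw [sub_neg_eq_add, ← sub_eq_add_neg] at h2
  rw [← mul_assoc, mul_cay h, h2, mul_one]

variable [Algebra ℝ R]

lemma isUnit_two : IsUnit (2 : R) := by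
  have : IsUnit (algebraMap ℝ R 2) := (IsUnit.mk0 (2 : ℝ) two_ne_zero).map _
  rwa [map_ofNat] at this

/-- The product `(1 + cay a) * (1 + a)` is `2`. Hence `cay` maps its domain into itself, where it is
an involution. -/
lemma isUnit_one_add_cay {a : R} (h : IsUnit (1 + a)) : IsUnit (1 + cay a) := by
  have h1 : (1 + cay a) * (1 + a) = 2 := by
    rw [add_mul, one_mul, cay_mul h, add_add_sub_cancel, one_add_one_eq_two]
  obtain ⟨v, hv⟩ := h
  rw [← hv] at h1
  rw [← Units.isUnit_mul_units _ v, h1]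
  exact isUnit_two

lemma cay_cay {a : R} (h : IsUnit (1 + a)) : cay (cay a) = a := by
  refine eq_cay (isUnit_one_add_cay h) ?_
  have h1 := mul_cay h
  rw [add_mul, one_mul] at h1
  rw [mul_add, mul_one, eq_sub_of_add_eq' h1]
  abel

lemma cay_one : cay (1 : R) = 0 :=
  eq_cay (by rw [one_add_one_eq_two]; exact isUnit_two) (by simp)

end Ring

variable {R : Type*} [NormedRing R] [CompleteSpace R]

lemma isOpen_isUnit_one_add : IsOpen {a : R | IsUnit (1 + a)} :=
  Units.isOpen.preimage (continuous_const.add continuous_id)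

variable [NormedAlgebra ℝ R]

lemma contDiffOn_cay : ContDiffOn ℝ ∞ (cay : R → R) {a | IsUnit (1 + a)} := by
  intro a ha
  obtain ⟨v, hv⟩ := ha
  have h1 : ContDiffAt ℝ ∞ (fun a : R => Ring.inverse (1 + a)) a := by
    have := contDiffAt_ringInverse ℝ (n := ∞) v
    rw [hv] at this
    exact this.comp a (contDiffAt_const.add contDiffAt_id)
  exact ((contDiffAt_const.sub contDiffAt_id).mul h1).contDiffWithinAt

/-- The chart `v ↦ cay (v g⁻¹)` of `R` around `g`. -/
def cayChart (g g' : R) (h : g * g' = 1) (h' : g' * g = 1) : OpenPartialHomeomorph R R where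
  toFun v := cay (v * g')
  invFun w := cay w * g
  source := {v | IsUnit (1 + v * g')}
  target := {w | IsUnit (1 + w)}
  map_source' v hv := isUnit_one_add_cay hv
  map_target' w hw := by
    rw [Set.mem_ofPred_eq, mul_assoc, h, mul_one]
    exact isUnit_one_add_cay hw
  left_inv' v hv := by
    rw [cay_cay hv, mul_assoc, h', mul_one]
  right_inv' w hw := by
    rw [mul_assoc, h, mul_one, cay_cay hw]
  open_source := isOpen_isUnit_one_add.preimage (continuous_id.mul continuous_const)
  open_target := isOpen_isUnit_one_add
  continuousOn_toFun := contDiffOn_cay.continuousOn.comp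
    (continuous_id.mul continuous_const).continuousOn fun _ h => h
  continuousOn_invFun := contDiffOn_cay.continuousOn.mul continuousOn_const

lemma contDiffOn_cayChart (g g' : R) (h : g * g' = 1) (h' : g' * g = 1) :
    ContDiffOn ℝ ∞ (cayChart g g' h h') (cayChart g g' h h').source :=
  contDiffOn_cay.comp (contDiff_id.mul contDiff_const).contDiffOn fun _ h => h

lemma contDiffOn_cayChart_symm (g g' : R) (h : g * g' = 1) (h' : g' * g = 1) :
    ContDiffOn ℝ ∞ (cayChart g g' h h').symm (cayChart g g' h h').target :=
  contDiffOn_cay.mul contDiffOn_const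

/-- Along a line through `0`, the derivative of `t ↦ cay (cay (t W) ^ 2)` at `0` is `2 W`. -/
lemma hasDerivAt_cay_sq (W : R) :
    HasDerivAt (fun t : ℝ => cay (cay (t • W) * cay (t • W))) ((2 : ℝ) • W) 0 := by
  have hopen : ∀ᶠ t : ℝ in 𝓝 0, IsUnit (1 + t • W) ∧ IsUnit (1 + (t * t) • (W * W)) := by
    have h0 : {a : R | IsUnit (1 + a)} ∈ 𝓝 (0 : R) := isOpen_isUnit_one_add.mem_nhds (by simp)
    have c1 : Continuous fun t : ℝ => t • W := by fun_prop
    have c2 : Continuous fun t : ℝ => (t * t) • (W * W) := by fun_prop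
    exact ((c1.tendsto' 0 0 (by simp)).eventually h0).and
      ((c2.tendsto' 0 0 (by simp)).eventually h0)
  -- With `A = t W`, the function is `2 A (1 + A²)⁻¹` near `0`; this closed form is differentiated
  -- instead.
  have h1 : HasDerivAt ((fun t : ℝ => (2 * t) • W) * fun t => Ring.inverse (1 + (t * t) • (W * W)))
      ((2 : ℝ) • W) 0 := by
    have h2 : DifferentiableAt ℝ
        (fun t : ℝ => Ring.inverse (1 + (t * t) • (W * W))) 0 := by
      have h3 : DifferentiableAt ℝ (Ring.inverse : R → R) (1 + ((0 : ℝ) * 0) • (W * W)) := by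
        simpa using differentiableAt_inverse (𝕜 := ℝ) (R := R) isUnit_one
      have h5 : DifferentiableAt ℝ (fun t : ℝ => 1 + (t * t) • (W * W)) 0 :=
        (((differentiableAt_id.mul differentiableAt_id).smul_const _).const_add _)
      exact DifferentiableAt.comp (0 : ℝ) h3 h5
    have h4 : HasDerivAt (fun t : ℝ => (2 * t) • W) ((2 : ℝ) • W) 0 := by
      simpa using ((hasDerivAt_id (0 : ℝ)).const_mul 2).smul_const W
    simpa using h4.mul h2.hasDerivAt
  refine h1.congr_of_eventuallyEq ?_
  filter_upwards [hopen] with t ht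
  rw [Pi.mul_apply]
  set A := t • W with hA
  have hAA : (t * t) • (W * W) = A * A := by rw [hA, smul_mul_smul_comm]
  rw [hAA] at ht ⊢
  have h2A : (2 * t) • W = 2 * A := by
    rw [hA, mul_smul, two_smul, two_mul]
  rw [h2A]
  have e1 := cay_mul ht.1
  have e2 := mul_cay ht.1
  have hc : cay A * A = A * cay A := (cay_intertwine ht.1 ht.1 rfl).symm
  set c := cay A
  -- Since `c (1 + A) = 1 - A`, one has `(1 ± c²)(1 + A)² = (1 + A)² ± (1 - A)²`; `key2` is the
  -- other sign.
  have key : (1 + c * c) * ((1 + A) * (1 + A)) = 2 * (1 + A * A) := by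
    calc (1 + c * c) * ((1 + A) * (1 + A))
        = (1 + A) * (1 + A) + c * (c * (1 + A)) * (1 + A) := by noncomm_ring
      _ = (1 + A) * (1 + A) + (c - c * A) * (1 + A) := by rw [e1]; noncomm_ring
      _ = (1 + A) * (1 + A) + (c * (1 + A) - A * (c * (1 + A))) := by rw [hc]; noncomm_ring
      _ = 2 * (1 + A * A) := by rw [e1]; noncomm_ring
  have key2 : (1 - c * c) * ((1 + A) * (1 + A)) = 2 * (A + A) := by
    calc (1 - c * c) * ((1 + A) * (1 + A))
        = (1 + A) * (1 + A) - c * (c * (1 + A)) * (1 + A) := by noncomm_ring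
      _ = (1 + A) * (1 + A) - (c - c * A) * (1 + A) := by rw [e1]; noncomm_ring
      _ = (1 + A) * (1 + A) - (c * (1 + A) - A * (c * (1 + A))) := by rw [hc]; noncomm_ring
      _ = 2 * (A + A) := by rw [e1]; noncomm_ring
  have hu2 : IsUnit ((1 + A) * (1 + A)) := ht.1.mul ht.1
  have hu : IsUnit (1 + c * c) := by
    obtain ⟨v, hv⟩ := hu2
    rw [← Units.isUnit_mul_units _ v, hv, key]
    exact isUnit_two.mul ht.2
  refine eq_cay hu (hu2.mul_left_injective ?_)
  change 2 * A * Ring.inverse (1 + A * A) * (1 + c * c) * ((1 + A) * (1 + A)) =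
    (1 - c * c) * ((1 + A) * (1 + A))
  rw [mul_assoc _ (1 + c * c), key, key2]
  have h2c : 2 * (1 + A * A) = (1 + A * A) * 2 := by noncomm_ring
  rw [h2c, mul_assoc, ← mul_assoc (Ring.inverse _), Ring.inverse_mul_cancel _ ht.2]
  noncomm_ring

end Cayley

/-! ### Slices of the matrix space in Cayley charts -/

section Slices

variable {n : ℕ}

instance completeSpace_matrix : CompleteSpace (Matrix (Fin n) (Fin n) ℝ) :=
  FiniteDimensional.complete ℝ _

lemma isUnit_transpose_iff {A : Matrix (Fin n) (Fin n) ℝ} : IsUnit Aᵀ ↔ IsUnit A := by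
  rw [Matrix.isUnit_iff_isUnit_det, Matrix.isUnit_iff_isUnit_det, det_transpose]

lemma isUnit_one_add_transpose {q : Matrix (Fin n) (Fin n) ℝ} (h : IsUnit (1 + q)) :
    IsUnit (1 + qᵀ) := by
  rwa [← transpose_one, ← transpose_add, isUnit_transpose_iff]

lemma cay_transpose {q : Matrix (Fin n) (Fin n) ℝ} (h : IsUnit (1 + q)) :
    cay qᵀ = (cay q)ᵀ := by
  refine eq_cay (isUnit_one_add_transpose h) ?_
  have := congrArg transpose (mul_cay h)
  rwa [transpose_mul, transpose_add, transpose_sub, transpose_one] at this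

/-- The Cayley transform turns inversion into negation, and here `qᵀ` is the inverse of `q`. -/
lemma cay_transpose_of_orthogonal {q : Matrix (Fin n) (Fin n) ℝ} (h : IsUnit (1 + q))
    (hq : q ∈ Matrix.orthogonalGroup (Fin n) ℝ) : (cay q)ᵀ = -cay q := by
  rw [← cay_transpose h]
  refine eq_cay (isUnit_one_add_transpose h) ?_
  have h1 := mem_orthogonalGroup_iff_mul_transpose.mp hq
  have h2 : 1 + qᵀ = (1 + q) * qᵀ := by rw [add_mul, one_mul, h1, add_comm]
  rw [h2, ← mul_assoc, neg_mul, cay_mul h, neg_sub, sub_mul, h1, one_mul]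

lemma isUnit_one_sub_of_skew {a : Matrix (Fin n) (Fin n) ℝ} (h : IsUnit (1 + a))
    (ha : aᵀ = -a) : IsUnit (1 - a) := by
  rw [sub_eq_add_neg, ← ha]
  exact isUnit_one_add_transpose h

lemma cay_mem_orthogonalGroup {a : Matrix (Fin n) (Fin n) ℝ} (h : IsUnit (1 + a))
    (ha : aᵀ = -a) : cay a ∈ Matrix.orthogonalGroup (Fin n) ℝ := by
  rw [mem_orthogonalGroup_iff_mul_transpose, ← cay_transpose h, ha,
    cay_mul_cay_neg h (isUnit_one_sub_of_skew h ha)]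

lemma mem_orthogonalGroup_iff_cay {q : Matrix (Fin n) (Fin n) ℝ} (h : IsUnit (1 + q)) :
    q ∈ Matrix.orthogonalGroup (Fin n) ℝ ↔ (cay q)ᵀ = -cay q := by
  refine ⟨cay_transpose_of_orthogonal h, fun ha => ?_⟩
  rw [← cay_cay h]
  exact cay_mem_orthogonalGroup (isUnit_one_add_cay h) ha

lemma commute_iff_cay {q B : Matrix (Fin n) (Fin n) ℝ} (h : IsUnit (1 + q)) :
    B * q = q * B ↔ B * cay q = cay q * B := by
  refine ⟨cay_intertwine h h, fun hB => ?_⟩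
  have := cay_intertwine (isUnit_one_add_cay h) (isUnit_one_add_cay h) hB
  rwa [cay_cay h] at this

/-- The left side says that `Y` intertwines `q` with `q⁻¹ = qᵀ`; the Cayley transform preserves
intertwining and sends `qᵀ` to `-cay q`. This linearizes the equation for square roots. -/
lemma mul_mul_self_iff_cay {q Y : Matrix (Fin n) (Fin n) ℝ} (h : IsUnit (1 + q))
    (hq : q ∈ Matrix.orthogonalGroup (Fin n) ℝ) :
    q * Y * q = Y ↔ Y * cay q = -(cay q * Y) := by
  have h1 := mem_orthogonalGroup_iff_transpose_mul.mp hq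
  have h2 := mem_orthogonalGroup_iff_mul_transpose.mp hq
  have e : -cay q = cay qᵀ := by rw [cay_transpose h, cay_transpose_of_orthogonal h hq]
  have hu := isUnit_one_add_transpose h
  rw [← neg_mul, e]
  constructor
  · intro hY
    refine cay_intertwine h hu ?_
    calc Y * q = qᵀ * q * (Y * q) := by rw [h1, one_mul]
      _ = qᵀ * (q * Y * q) := by simp only [mul_assoc]
      _ = qᵀ * Y := by rw [hY]
  · intro hY
    have h3 := cay_intertwine (isUnit_one_add_cay h) (isUnit_one_add_cay hu) hY
    rw [cay_cay h, cay_cay hu] at h3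
    rw [mul_assoc, h3, ← mul_assoc, h2, one_mul]

/-- Every `d`-dimensional subspace has a linear parametrization with a linear left inverse. -/
lemma exists_parametrization {V : Type} [NormedAddCommGroup V] [NormedSpace ℝ V]
    [FiniteDimensional ℝ V] {d : ℕ} (L : Submodule ℝ V) (h : Module.finrank ℝ L = d) :
    ∃ (i : EuclideanSpace ℝ (Fin d) →L[ℝ] V) (p : V →L[ℝ] EuclideanSpace ℝ (Fin d)),
      (∀ v, p (i v) = v) ∧ (∀ v, i v ∈ L) ∧ ∀ w, i (p w) = w ↔ w ∈ L := by
  obtain ⟨C, hC⟩ := Submodule.exists_isCompl L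
  let e : EuclideanSpace ℝ (Fin d) ≃ₗ[ℝ] L := LinearEquiv.ofFinrankEq _ _ (by simp [h])
  let i : EuclideanSpace ℝ (Fin d) →ₗ[ℝ] V := L.subtype ∘ₗ e.toLinearMap
  let p : V →ₗ[ℝ] EuclideanSpace ℝ (Fin d) :=
    e.symm.toLinearMap ∘ₗ Submodule.projectionOnto L C hC
  have hi : ∀ v, i v ∈ L := fun v => (e v).2
  refine ⟨i.toContinuousLinearMap, p.toContinuousLinearMap, fun v => ?_, hi, fun w => ?_⟩
  · change e.symm (Submodule.projectionOnto L C hC (e v)) = v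
    rw [Submodule.projectionOnto_apply_left, e.symm_apply_apply]
  · constructor
    · intro hw
      rw [← hw]
      exact hi _
    · intro hw
      change ((e (e.symm (Submodule.projectionOnto L C hC w)) : L) : V) = w
      rw [e.apply_symm_apply]
      exact congrArg Subtype.val (Submodule.projectionOnto_apply_left hC ⟨w, hw⟩)

/-- The Cayley chart of the matrix space around an orthogonal matrix. -/
def orthChart (g : Matrix.orthogonalGroup (Fin n) ℝ) :
    OpenPartialHomeomorph (Matrix (Fin n) (Fin n) ℝ) (Matrix (Fin n) (Fin n) ℝ) :=
  cayChart (g : Matrix (Fin n) (Fin n) ℝ) (g : Matrix (Fin n) (Fin n) ℝ)ᵀ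
    (mem_orthogonalGroup_iff_mul_transpose.mp g.2) (mem_orthogonalGroup_iff_transpose_mul.mp g.2)

/-- Slices of the orthogonal group in the Cayley charts. -/
def cayleySliceAtlas {X : Type} [TopologicalSpace X] {ι : X → Matrix.orthogonalGroup (Fin n) ℝ}
    (hι : IsEmbedding ι) {d : ℕ} (L : X → Submodule ℝ (Matrix (Fin n) (Fin n) ℝ))
    (hd : ∀ x, Module.finrank ℝ (L x) = d)
    (hL : ∀ x, ∀ v : Matrix (Fin n) (Fin n) ℝ,
      IsUnit (1 + v * (ι x : Matrix (Fin n) (Fin n) ℝ)ᵀ) →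
      ((∃ y, (ι y : Matrix (Fin n) (Fin n) ℝ) = v) ↔
        cay (v * (ι x : Matrix (Fin n) (Fin n) ℝ)ᵀ) ∈ L x)) :
    SliceAtlas (fun x => (ι x : Matrix (Fin n) (Fin n) ℝ)) d where
  isEmbedding := IsEmbedding.subtypeVal.comp hι
  Φ x := orthChart (ι x)
  mem_source x := by
    change IsUnit (1 + (ι x : Matrix (Fin n) (Fin n) ℝ) * (ι x : Matrix (Fin n) (Fin n) ℝ)ᵀ)
    rw [mem_orthogonalGroup_iff_mul_transpose.mp (ι x).2, one_add_one_eq_two]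
    exact isUnit_two
  contDiffOn x := contDiffOn_cayChart _ _ _ _
  contDiffOn_symm x := contDiffOn_cayChart_symm _ _ _ _
  i x := (exists_parametrization (L x) (hd x)).choose
  p x := (exists_parametrization (L x) (hd x)).choose_spec.choose
  p_i x := (exists_parametrization (L x) (hd x)).choose_spec.choose_spec.1
  mem_range_iff x v hv :=
    (hL x v hv).trans ((exists_parametrization (L x) (hd x)).choose_spec.choose_spec.2.2 _).symm

section

variable {X : Type} [TopologicalSpace X] {ι : X → Matrix.orthogonalGroup (Fin n) ℝ}
    (hι : IsEmbedding ι) {d : ℕ} (L : X → Submodule ℝ (Matrix (Fin n) (Fin n) ℝ))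
    (hd : ∀ x, Module.finrank ℝ (L x) = d)
    (hL : ∀ x, ∀ v : Matrix (Fin n) (Fin n) ℝ,
      IsUnit (1 + v * (ι x : Matrix (Fin n) (Fin n) ℝ)ᵀ) →
      ((∃ y, (ι y : Matrix (Fin n) (Fin n) ℝ) = v) ↔
        cay (v * (ι x : Matrix (Fin n) (Fin n) ℝ)ᵀ) ∈ L x))

lemma cayleySliceAtlas_i_mem (x : X) (v : EuclideanSpace ℝ (Fin d)) :
    (cayleySliceAtlas hι L hd hL).i x v ∈ L x :=
  (exists_parametrization (L x) (hd x)).choose_spec.choose_spec.2.1 v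

lemma cayleySliceAtlas_i_p (x : X) {w : Matrix (Fin n) (Fin n) ℝ} (hw : w ∈ L x) :
    (cayleySliceAtlas hι L hd hL).i x ((cayleySliceAtlas hι L hd hL).p x w) = w :=
  ((exists_parametrization (L x) (hd x)).choose_spec.choose_spec.2.2 w).mpr hw

lemma cayleySliceAtlas_chart_self (x : X) :
    (cayleySliceAtlas hι L hd hL).chart x x = 0 := by
  change (cayleySliceAtlas hι L hd hL).p x (cay (_ * _)) = 0
  rw [mem_orthogonalGroup_iff_mul_transpose.mp (ι x).2, cay_one, map_zero]

lemma cayleySliceAtlas_embedsIn {Y : Type} [TopologicalSpace Y]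
    {κ : Y → Matrix.orthogonalGroup (Fin n) ℝ}
    (hκ : IsEmbedding κ) {e : ℕ} (L' : Y → Submodule ℝ (Matrix (Fin n) (Fin n) ℝ))
    (hd' : ∀ x, Module.finrank ℝ (L' x) = e)
    (hL' : ∀ x, ∀ v : Matrix (Fin n) (Fin n) ℝ,
      IsUnit (1 + v * (κ x : Matrix (Fin n) (Fin n) ℝ)ᵀ) →
      ((∃ y, (κ y : Matrix (Fin n) (Fin n) ℝ) = v) ↔
        cay (v * (κ x : Matrix (Fin n) (Fin n) ℝ)ᵀ) ∈ L' x))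
    {f : X → Y} (hf : ∀ x, κ (f x) = ι x) (hle : ∀ x, L x ≤ L' (f x)) :
    (cayleySliceAtlas hι L hd hL).smoothStructure.EmbedsIn
      (cayleySliceAtlas hκ L' hd' hL').smoothStructure f := by
  refine (cayleySliceAtlas hι L hd hL).embedsIn (cayleySliceAtlas hκ L' hd' hL')
    (fun x => by rw [hf]) (fun x => ?_) fun x v => ?_
  · change orthChart (ι x) = orthChart (κ (f x))
    rw [hf]
  · exact cayleySliceAtlas_i_p hκ L' hd' hL' (f x)
      (hle x (cayleySliceAtlas_i_mem hι L hd hL x v))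

end

/-- The skew-symmetric matrices. -/
def skewSubmodule (n : ℕ) : Submodule ℝ (Matrix (Fin n) (Fin n) ℝ) where
  carrier := {X | Xᵀ = -X}
  add_mem' {X Y} hX hY := by
    rw [Set.mem_ofPred_eq] at *
    rw [transpose_add, hX, hY, neg_add]
  zero_mem' := by simp
  smul_mem' c X hX := by
    rw [Set.mem_ofPred_eq] at *
    rw [transpose_smul, hX, smul_neg]

/-- The matrices `X` with `B X = s X B`. -/
def twistedCommutant (s : ℝ) (B : Matrix (Fin n) (Fin n) ℝ) :
    Submodule ℝ (Matrix (Fin n) (Fin n) ℝ) where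
  carrier := {X | B * X = s • (X * B)}
  add_mem' {X Y} hX hY := by
    rw [Set.mem_ofPred_eq] at *
    rw [mul_add, hX, hY, add_mul, smul_add]
  zero_mem' := by simp
  smul_mem' c X hX := by
    rw [Set.mem_ofPred_eq] at *
    rw [Matrix.mul_smul, hX, Matrix.smul_mul, smul_comm]

lemma mem_skewSubmodule {X : Matrix (Fin n) (Fin n) ℝ} : X ∈ skewSubmodule n ↔ Xᵀ = -X := Iff.rfl

lemma mem_twistedCommutant_one {B X : Matrix (Fin n) (Fin n) ℝ} :
    X ∈ twistedCommutant 1 B ↔ B * X = X * B := by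
  change B * X = (1 : ℝ) • (X * B) ↔ _
  rw [one_smul]

lemma mem_twistedCommutant_neg_one {B X : Matrix (Fin n) (Fin n) ℝ} :
    X ∈ twistedCommutant (-1) B ↔ B * X = -(X * B) := by
  change B * X = (-1 : ℝ) • (X * B) ↔ _
  rw [neg_one_smul]

/-- Conjugate matrices have twisted commutants of the same dimension. -/
lemma finrank_twistedCommutant_conj {C : Matrix (Fin n) (Fin n) ℝ}
    (hC : C ∈ Matrix.orthogonalGroup (Fin n) ℝ) (s : ℝ) (B : Matrix (Fin n) (Fin n) ℝ) :
    Module.finrank ℝ ↥(skewSubmodule n ⊓ twistedCommutant s (C * B * Cᵀ)) =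
      Module.finrank ℝ ↥(skewSubmodule n ⊓ twistedCommutant s B) := by
  have key : ∀ {C : Matrix (Fin n) (Fin n) ℝ}, C ∈ Matrix.orthogonalGroup (Fin n) ℝ →
      ∀ B : Matrix (Fin n) (Fin n) ℝ,
      Module.finrank ℝ ↥(skewSubmodule n ⊓ twistedCommutant s B) ≤
        Module.finrank ℝ ↥(skewSubmodule n ⊓ twistedCommutant s (C * B * Cᵀ)) := by
    intro C hC B
    have h1 := mem_orthogonalGroup_iff_transpose_mul.mp hC
    have hmap : ∀ X ∈ skewSubmodule n ⊓ twistedCommutant s B,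
        C * X * Cᵀ ∈ skewSubmodule n ⊓ twistedCommutant s (C * B * Cᵀ) := by
      rintro X ⟨hX, hX'⟩
      have hX1 : Xᵀ = -X := hX
      have hX2 : B * X = s • (X * B) := hX'
      refine ⟨?_, ?_⟩
      · change (C * X * Cᵀ)ᵀ = -(C * X * Cᵀ)
        rw [transpose_mul, transpose_mul, transpose_transpose, hX1]
        simp only [mul_assoc, neg_mul, mul_neg]
      · change C * B * Cᵀ * (C * X * Cᵀ) = s • (C * X * Cᵀ * (C * B * Cᵀ))
        calc C * B * Cᵀ * (C * X * Cᵀ) = C * B * (Cᵀ * C) * X * Cᵀ := by simp only [mul_assoc]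
          _ = C * (B * X) * Cᵀ := by rw [h1]; simp only [mul_assoc, mul_one]
          _ = s • (C * X * (Cᵀ * C) * B * Cᵀ) := by
              rw [hX2, h1, Matrix.mul_smul, Matrix.smul_mul]; simp only [mul_assoc, mul_one]
          _ = _ := by simp only [mul_assoc]
    let f : Matrix (Fin n) (Fin n) ℝ →ₗ[ℝ] Matrix (Fin n) (Fin n) ℝ :=
      { toFun := fun X => C * X * Cᵀ
        map_add' := fun X Y => by rw [mul_add, add_mul]
        map_smul' := fun c X => by rw [Matrix.mul_smul, Matrix.smul_mul, RingHom.id_apply] }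
    refine LinearMap.finrank_le_finrank_of_injective (f := f.restrict hmap) ?_
    intro X Y hXY
    have h2 : C * (X : Matrix (Fin n) (Fin n) ℝ) * Cᵀ = C * Y * Cᵀ := congrArg Subtype.val hXY
    apply Subtype.ext
    have h3 := congrArg (fun Z => Cᵀ * Z * C) h2
    have e : ∀ Z : Matrix (Fin n) (Fin n) ℝ, Cᵀ * (C * Z * Cᵀ) * C = Z := fun Z => by
      calc Cᵀ * (C * Z * Cᵀ) * C = (Cᵀ * C) * Z * (Cᵀ * C) := by simp only [mul_assoc]
        _ = Z := by rw [h1, one_mul, mul_one]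
    simpa only [e] using h3
  refine le_antisymm ?_ (key hC B)
  have h1 := mem_orthogonalGroup_iff_transpose_mul.mp hC
  have h2 := key (transpose_mem_orthogonalGroup hC) (C * B * Cᵀ)
  have e : Cᵀ * (C * B * Cᵀ) * Cᵀᵀ = B := by
    calc Cᵀ * (C * B * Cᵀ) * Cᵀᵀ = (Cᵀ * C) * B * (Cᵀ * C) := by
          simp only [mul_assoc, transpose_transpose]
      _ = B := by rw [h1, one_mul, mul_one]
  rwa [e] at h2

end Slices

/-! ### Quotients of compact groups -/

/-- A continuous bijection from a compact space to a Hausdorff space is a homeomorphism. -/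
lemma exists_homeomorph_quotient {G S : Type*} [Group G] [TopologicalSpace G] [CompactSpace G]
    [TopologicalSpace S] [T2Space S] (H : Subgroup G) {f : G → S} (hf : Continuous f)
    (hs : Function.Surjective f) (hH : ∀ a b, f a = f b ↔ a⁻¹ * b ∈ H) :
    ∃ e : G ⧸ H ≃ₜ S, ∀ g : G, e g = f g := by
  have hlift : ∀ a b : G, QuotientGroup.leftRel H a b → f a = f b := fun a b hab =>
    (hH a b).mpr (QuotientGroup.leftRel_apply.mp hab)
  let F : G ⧸ H → S := fun q => Quotient.liftOn' q f hlift
  have hF : ∀ g : G, F g = f g := fun g => rfl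
  have hFc : Continuous F := hf.quotient_liftOn' hlift
  have hFb : Function.Bijective F := by
    refine ⟨fun p q => ?_, fun y => ?_⟩
    · induction p using QuotientGroup.induction_on
      induction q using QuotientGroup.induction_on
      rw [hF, hF, QuotientGroup.eq]
      exact (hH _ _).mp
    · obtain ⟨g, rfl⟩ := hs y
      exact ⟨g, rfl⟩
  exact ⟨hFc.homeoOfEquivCompactToT2 (f := Equiv.ofBijective F hFb), hF⟩

section Orbit

variable {n : ℕ}

lemma isCompact_orthogonalGroup :
    IsCompact (Matrix.orthogonalGroup (Fin n) ℝ : Set (Matrix (Fin n) (Fin n) ℝ)) := by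
  have : ProperSpace (Matrix (Fin n) (Fin n) ℝ) := FiniteDimensional.proper ℝ _
  refine Metric.isCompact_of_isClosed_isBounded (isClosed_unitary (R := Matrix (Fin n) (Fin n) ℝ))
    (isBounded_iff_forall_norm_le.mpr ⟨‖(1 : Matrix (Fin n) (Fin n) ℝ)‖ + 1, fun U hU => ?_⟩)
  have h1 : ‖U‖ * ‖U‖ = ‖(1 : Matrix (Fin n) (Fin n) ℝ)‖ := by
    rw [← CStarRing.norm_star_mul_self, Unitary.star_mul_self_of_mem hU]
  nlinarith [norm_nonneg U]

instance compactSpace_orthComm (B : Matrix (Fin n) (Fin n) ℝ) : CompactSpace (orthComm B) := by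
  have : CompactSpace (Matrix.orthogonalGroup (Fin n) ℝ) :=
    isCompact_iff_compactSpace.mp isCompact_orthogonalGroup
  have h : IsClosed {X : Matrix.orthogonalGroup (Fin n) ℝ |
      B * (X : Matrix (Fin n) (Fin n) ℝ) = X * B} :=
    isClosed_eq (by fun_prop) (by fun_prop)
  exact isCompact_iff_compactSpace.mp h.isCompact

lemma mul_transpose_mem_orthogonalGroup_iff {v : Matrix (Fin n) (Fin n) ℝ}
    (g : Matrix.orthogonalGroup (Fin n) ℝ) :
    v * (g : Matrix (Fin n) (Fin n) ℝ)ᵀ ∈ Matrix.orthogonalGroup (Fin n) ℝ ↔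
      v ∈ Matrix.orthogonalGroup (Fin n) ℝ := by
  refine ⟨fun h => ?_, fun h => mul_mem_orthogonalGroup h (transpose_mem_orthogonalGroup g.2)⟩
  have := mul_mem_orthogonalGroup h g.2
  rwa [mul_assoc, mem_orthogonalGroup_iff_transpose_mul.mp g.2, mul_one] at this

/-! ### The smooth structures of the orthogonal group and of its centralizers -/

lemma orthogonal_slice (g : Matrix.orthogonalGroup (Fin n) ℝ) (v : Matrix (Fin n) (Fin n) ℝ)
    (h : IsUnit (1 + v * (g : Matrix (Fin n) (Fin n) ℝ)ᵀ)) :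
    (∃ y : Matrix.orthogonalGroup (Fin n) ℝ, (y : Matrix (Fin n) (Fin n) ℝ) = v) ↔
      cay (v * (g : Matrix (Fin n) (Fin n) ℝ)ᵀ) ∈ skewSubmodule n := by
  rw [mem_skewSubmodule, ← mem_orthogonalGroup_iff_cay h, mul_transpose_mem_orthogonalGroup_iff]
  exact ⟨fun ⟨y, hy⟩ => hy ▸ y.2, fun hv => ⟨⟨v, hv⟩, rfl⟩⟩

lemma mem_orthComm {B : Matrix (Fin n) (Fin n) ℝ} {X : Matrix.orthogonalGroup (Fin n) ℝ} :
    X ∈ orthComm B ↔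
      B * (X : Matrix (Fin n) (Fin n) ℝ) = (X : Matrix (Fin n) (Fin n) ℝ) * B := Iff.rfl

/-- As `gᵀ = g⁻¹` commutes with `B`, so does `v gᵀ` exactly when `v` does, and `cay` preserves
commutation. -/
lemma orthComm_slice {B : Matrix (Fin n) (Fin n) ℝ} (g : orthComm B)
    (v : Matrix (Fin n) (Fin n) ℝ)
    (h : IsUnit (1 + v * ((g : Matrix.orthogonalGroup (Fin n) ℝ) : Matrix (Fin n) (Fin n) ℝ)ᵀ)) :
    (∃ y : orthComm B,
        ((y : Matrix.orthogonalGroup (Fin n) ℝ) : Matrix (Fin n) (Fin n) ℝ) = v) ↔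
      cay (v * ((g : Matrix.orthogonalGroup (Fin n) ℝ) : Matrix (Fin n) (Fin n) ℝ)ᵀ) ∈
        skewSubmodule n ⊓ twistedCommutant 1 B := by
  obtain ⟨g, hg⟩ := g
  rw [Submodule.mem_inf, ← orthogonal_slice g v h, mem_twistedCommutant_one, ← commute_iff_cay h]
  have hg' : B * (g : Matrix (Fin n) (Fin n) ℝ)ᵀ = (g : Matrix (Fin n) (Fin n) ℝ)ᵀ * B :=
    mem_orthComm.mp ((orthComm B).inv_mem hg)
  have hgg := mem_orthogonalGroup_iff_transpose_mul.mp g.2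
  have hc : B * (v * (g : Matrix (Fin n) (Fin n) ℝ)ᵀ) = v * (g : Matrix (Fin n) (Fin n) ℝ)ᵀ * B ↔
      B * v = v * B := by
    rw [mul_assoc v, ← hg', ← mul_assoc, ← mul_assoc]
    refine ⟨fun h => ?_, fun h => by rw [h]⟩
    have := congrArg (· * (g : Matrix (Fin n) (Fin n) ℝ)) h
    simpa only [mul_assoc, hgg, mul_one] using this
  rw [hc]
  constructor
  · rintro ⟨y, rfl⟩
    exact ⟨⟨y.1, rfl⟩, y.2⟩
  · rintro ⟨⟨y, rfl⟩, hy⟩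
    exact ⟨⟨y, hy⟩, rfl⟩

/-- The Cayley charts of the orthogonal group. -/
def orthogonalSliceAtlas (n : ℕ) :
    SliceAtlas (fun x : Matrix.orthogonalGroup (Fin n) ℝ => (x : Matrix (Fin n) (Fin n) ℝ))
      (Module.finrank ℝ (skewSubmodule n)) :=
  cayleySliceAtlas (ι := id) IsEmbedding.id (fun _ => skewSubmodule n) (fun _ => rfl)
    orthogonal_slice

/-- The Cayley charts of the centralizer of a matrix in the orthogonal group. -/
def orthCommSliceAtlas (B : Matrix (Fin n) (Fin n) ℝ) :
    SliceAtlas (fun x : orthComm B =>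
        ((x : Matrix.orthogonalGroup (Fin n) ℝ) : Matrix (Fin n) (Fin n) ℝ))
      (Module.finrank ℝ ↥(skewSubmodule n ⊓ twistedCommutant 1 B)) :=
  cayleySliceAtlas IsEmbedding.subtypeVal (fun _ => skewSubmodule n ⊓ twistedCommutant 1 B)
    (fun _ => rfl) orthComm_slice

/-! ### Families of orthogonal square roots of constant spectrum -/

/-- An orthogonal square root `v` of `Y * Y` such that `1 + v * Yᵀ` is invertible is conjugate
to `Y`. -/
lemma charpoly_eq_of_mul_mul_self {q Y : Matrix (Fin n) (Fin n) ℝ} (h : IsUnit (1 + q))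
    (hq : q * Y * q = Y) : (q * Y).charpoly = Y.charpoly := by
  obtain ⟨U, hU⟩ := h
  -- `1 + q` conjugates `Y` to `q Y`: both `(1 + q) Y` and `q Y (1 + q)` equal `Y + q Y`.
  have h1 : (U : Matrix (Fin n) (Fin n) ℝ) * (Y * U.inv) = q * Y := by
    have h2 : (U : Matrix (Fin n) (Fin n) ℝ) * Y = q * Y * U := by
      rw [hU, add_mul, mul_add, hq, one_mul, mul_one, add_comm]
    rw [← mul_assoc, h2, mul_assoc, U.val_inv, mul_one]
  rw [← h1, ← mul_assoc]
  exact charpoly_conj _ _ _ U.inv_val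

/-- The set `S` of orthogonal matrices is flattened by Cayley charts if it consists of square
roots of one matrix and is determined by the characteristic polynomial among them. -/
lemma squareRoots_slice {S : Set (Matrix (Fin n) (Fin n) ℝ)} {M : Matrix (Fin n) (Fin n) ℝ}
    (hS : S ⊆ OSR M) (hchar : ∀ Y ∈ S, ∀ v ∈ OSR M, v.charpoly = Y.charpoly → v ∈ S)
    {Y : Matrix.orthogonalGroup (Fin n) ℝ} (hY : (Y : Matrix (Fin n) (Fin n) ℝ) ∈ S)
    {v : Matrix (Fin n) (Fin n) ℝ} (h : IsUnit (1 + v * (Y : Matrix (Fin n) (Fin n) ℝ)ᵀ)) :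
    v ∈ S ↔ cay (v * (Y : Matrix (Fin n) (Fin n) ℝ)ᵀ) ∈
      skewSubmodule n ⊓ twistedCommutant (-1) (Y : Matrix (Fin n) (Fin n) ℝ) := by
  set q := v * (Y : Matrix (Fin n) (Fin n) ℝ)ᵀ with hq
  have hYY := mem_orthogonalGroup_iff_transpose_mul.mp Y.2
  have hv : v = q * Y := by rw [hq, mul_assoc, hYY, mul_one]
  have hY2 : (Y : Matrix (Fin n) (Fin n) ℝ) * Y = M := (hS hY).2
  rw [Submodule.mem_inf, mem_skewSubmodule, ← mem_orthogonalGroup_iff_cay h,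
    mem_twistedCommutant_neg_one]
  constructor
  · intro hvS
    have hqo : q ∈ Matrix.orthogonalGroup (Fin n) ℝ :=
      (mul_transpose_mem_orthogonalGroup_iff Y).mpr (hS hvS).1
    refine ⟨hqo, (mul_mul_self_iff_cay h hqo).mp ?_⟩
    have h1 : q * Y * q * Y = (Y : Matrix (Fin n) (Fin n) ℝ) * Y := by
      rw [hY2, mul_assoc _ q, ← hv]
      exact (hS hvS).2
    have h2 := congrArg (· * (Y : Matrix (Fin n) (Fin n) ℝ)ᵀ) h1
    simpa only [mul_assoc, mem_orthogonalGroup_iff_mul_transpose.mp Y.2, mul_one] using h2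
  · rintro ⟨hqo, hqc⟩
    have h1 := (mul_mul_self_iff_cay h hqo).mpr hqc
    refine hchar Y hY v ⟨(mul_transpose_mem_orthogonalGroup_iff Y).mp hqo, ?_⟩ ?_
    · rw [hv, ← mul_assoc, h1, hY2]
    · rw [hv, charpoly_eq_of_mul_mul_self h h1]

end Orbit

section Geometry

variable {n : ℕ}

/-! ### Orbits of orthogonal square roots -/

/-- If `a` anticommutes with `Y`, then congruence by the Cayley transform of `a` multiplies `Y` by
the square of this transform. -/
lemma cay_mul_mul_cay_transpose {Y a : Matrix (Fin n) (Fin n) ℝ} (h : IsUnit (1 + a))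
    (ha : aᵀ = -a) (hY : Y * a = -(a * Y)) : cay a * Y * (cay a)ᵀ = cay a * cay a * Y := by
  have h' := isUnit_one_sub_of_skew h ha
  rw [← cay_transpose h, ha, mul_assoc, mul_assoc]
  congr 1
  exact cay_intertwine (by rwa [← sub_eq_add_neg]) h (by rw [mul_neg, hY, neg_neg])

/-- Identifies the fibres of the orbit map with the cosets of the stabilizer of `Z`. -/
lemma orbit_stabilizer {C Z : Matrix (Fin n) (Fin n) ℝ}
    (hC : C ∈ Matrix.orthogonalGroup (Fin n) ℝ) (a b : Matrix.orthogonalGroup (Fin n) ℝ) :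
    C * (a : Matrix (Fin n) (Fin n) ℝ) * Z * (a : Matrix (Fin n) (Fin n) ℝ)ᵀ * Cᵀ =
        C * (b : Matrix (Fin n) (Fin n) ℝ) * Z * (b : Matrix (Fin n) (Fin n) ℝ)ᵀ * Cᵀ ↔
      a⁻¹ * b ∈ orthComm Z := by
  have hCC := mem_orthogonalGroup_iff_transpose_mul.mp hC
  have ha := mem_orthogonalGroup_iff_transpose_mul.mp a.2
  have ha' := mem_orthogonalGroup_iff_mul_transpose.mp a.2
  have hb := mem_orthogonalGroup_iff_transpose_mul.mp b.2
  have hb' := mem_orthogonalGroup_iff_mul_transpose.mp b.2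
  generalize hA : (a : Matrix (Fin n) (Fin n) ℝ) = A at *
  generalize hB : (b : Matrix (Fin n) (Fin n) ℝ) = B at *
  have e : ((a⁻¹ * b : Matrix.orthogonalGroup (Fin n) ℝ) : Matrix (Fin n) (Fin n) ℝ) =
      Aᵀ * B := by rw [← hA, ← hB]; rfl
  rw [mem_orthComm, e]
  constructor
  · intro h
    have h1 : A * Z * Aᵀ = B * Z * Bᵀ := by
      have h2 := congrArg (fun X => Cᵀ * X * C) h
      have e2 : ∀ X : Matrix (Fin n) (Fin n) ℝ, Cᵀ * (C * X * Z * Xᵀ * Cᵀ) * C = X * Z * Xᵀ :=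
        fun X => by
          calc Cᵀ * (C * X * Z * Xᵀ * Cᵀ) * C = (Cᵀ * C) * (X * Z * Xᵀ) * (Cᵀ * C) := by
                simp only [mul_assoc]
            _ = _ := by rw [hCC, one_mul, mul_one]
      simpa only [e2] using h2
    calc Z * (Aᵀ * B) = (Aᵀ * A) * Z * Aᵀ * B := by rw [ha, one_mul, mul_assoc]
      _ = Aᵀ * (A * Z * Aᵀ) * B := by simp only [mul_assoc]
      _ = Aᵀ * B * Z * (Bᵀ * B) := by rw [h1]; simp only [mul_assoc]
      _ = Aᵀ * B * Z := by rw [hb, mul_one]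
  · intro h
    have h1 : A * Z * Aᵀ = B * Z * Bᵀ := by
      calc A * Z * Aᵀ = A * Z * Aᵀ * (B * Bᵀ) := by rw [hb', mul_one]
        _ = A * (Z * (Aᵀ * B)) * Bᵀ := by simp only [mul_assoc]
        _ = (A * Aᵀ) * B * Z * Bᵀ := by rw [h]; simp only [mul_assoc]
        _ = B * Z * Bᵀ := by rw [ha', one_mul]
    calc C * A * Z * Aᵀ * Cᵀ = C * (A * Z * Aᵀ) * Cᵀ := by simp only [mul_assoc]
      _ = _ := by rw [h1]; simp only [mul_assoc]

/-- The derivative computation behind the submersion `g ↦ C g Z gᵀ Cᵀ`. -/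
lemma hasDerivAt_orbit {C Z g X W : Matrix (Fin n) (Fin n) ℝ}
    (hC : C ∈ Matrix.orthogonalGroup (Fin n) ℝ) {Y : Matrix (Fin n) (Fin n) ℝ}
    (hY : Y * Yᵀ = 1) (hYg : Y = C * g * Z * gᵀ * Cᵀ) (hX : C * X * Cᵀ = W) (hW : Wᵀ = -W)
    (hYW : Y * W = -(W * Y)) :
    HasDerivAt (fun t : ℝ => cay (C * (cay (t • X) * g) * Z * (cay (t • X) * g)ᵀ * Cᵀ * Yᵀ))
      ((2 : ℝ) • W) 0 := by
  refine (hasDerivAt_cay_sq W).congr_of_eventuallyEq ?_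
  have hopen : ∀ᶠ t : ℝ in 𝓝 0, IsUnit (1 + t • W) ∧ IsUnit (1 + t • X) := by
    have h0 : {a : Matrix (Fin n) (Fin n) ℝ | IsUnit (1 + a)} ∈ 𝓝 0 :=
      isOpen_isUnit_one_add.mem_nhds (by simp)
    have key : ∀ A : Matrix (Fin n) (Fin n) ℝ, ∀ᶠ t : ℝ in 𝓝 0, IsUnit (1 + t • A) := fun A => by
      have c : Continuous fun t : ℝ => t • A := by fun_prop
      exact c.continuousAt.preimage_mem_nhds (by rw [zero_smul]; exact h0)
    exact (key W).and (key X)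
  filter_upwards [hopen] with t ht
  have hCC := mem_orthogonalGroup_iff_transpose_mul.mp hC
  have h1 : C * cay (t • X) = cay (t • W) * C := by
    refine cay_intertwine ht.2 ht.1 ?_
    rw [← hX, Matrix.mul_smul, Matrix.smul_mul, mul_assoc (C * X), hCC, mul_one]
  have h2 := cay_mul_mul_cay_transpose ht.1 (by rw [transpose_smul, hW, smul_neg])
    (Y := Y) (by rw [Matrix.mul_smul, hYW, Matrix.smul_mul, smul_neg])
  congr 1
  calc C * (cay (t • X) * g) * Z * (cay (t • X) * g)ᵀ * Cᵀ * Yᵀ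
      = (C * cay (t • X)) * g * Z * gᵀ * (C * cay (t • X))ᵀ * Yᵀ := by
        simp only [transpose_mul, mul_assoc]
    _ = cay (t • W) * Y * (cay (t • W))ᵀ * Yᵀ := by
        rw [h1, hYg]; simp only [transpose_mul, mul_assoc]
    _ = cay (t • W) * cay (t • W) := by rw [h2, mul_assoc, hY, mul_one]

/-- An orbit of orthogonal square roots which is determined by its characteristic polynomial is an
embedded submanifold of the orthogonal group, diffeomorphic to a homogeneous space. -/
theorem exists_smoothStructures {C J Z : Matrix (Fin n) (Fin n) ℝ}
    {S : Set (Matrix (Fin n) (Fin n) ℝ)}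
    (hC : C ∈ Matrix.orthogonalGroup (Fin n) ℝ)
    (hS : S ⊆ OSR (C * J * Cᵀ))
    (hchar : ∀ Y ∈ S, ∀ v ∈ OSR (C * J * Cᵀ), v.charpoly = Y.charpoly → v ∈ S)
    (horbit : S = {Y | ∃ X ∈ orthComm J, Y = C * (X : Matrix (Fin n) (Fin n) ℝ) * Z *
      (X : Matrix (Fin n) (Fin n) ℝ)ᵀ * Cᵀ}) :
    IsCompact S ∧
    ∃ (𝒪 : SmoothStructure (Matrix.orthogonalGroup (Fin n) ℝ))
      (𝒮 : SmoothStructure {Y : Matrix.orthogonalGroup (Fin n) ℝ //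
        (Y : Matrix (Fin n) (Fin n) ℝ) ∈ S})
      (𝒢 : SmoothStructure (orthComm J))
      (𝒬 : SmoothStructure (orthComm J ⧸ (orthComm Z).subgroupOf (orthComm J))),
      𝒪.EmbedsInSpace (Subtype.val : _ → Matrix (Fin n) (Fin n) ℝ) ∧
      𝒮.EmbedsIn 𝒪 Subtype.val ∧
      𝒢.EmbedsIn 𝒪 Subtype.val ∧
      𝒢.SubmersesOnto 𝒬 QuotientGroup.mk ∧
      𝒮.Diffeomorphic 𝒬 := by
  let P : Matrix (Fin n) (Fin n) ℝ → Matrix (Fin n) (Fin n) ℝ := fun g => C * g * Z * gᵀ * Cᵀ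
  have htr : ContDiff ℝ ∞ (fun g : Matrix (Fin n) (Fin n) ℝ => gᵀ) :=
    (LinearMap.toContinuousLinearMap
      (Matrix.transposeLinearEquiv (Fin n) (Fin n) ℝ ℝ).toLinearMap).contDiff
  have hP : ContDiff ℝ ∞ P :=
    (((contDiff_const.mul contDiff_id).mul contDiff_const).mul htr).mul contDiff_const
  have hPS : ∀ g ∈ orthComm J, P g ∈ S := fun g hg => by
    rw [horbit]; exact ⟨g, hg, rfl⟩
  have hcoe : Continuous fun g : orthComm J =>
      P ((g : Matrix.orthogonalGroup (Fin n) ℝ) : Matrix (Fin n) (Fin n) ℝ) :=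
    hP.continuous.comp (continuous_subtype_val.comp continuous_subtype_val)
  have hcomp : IsCompact S := by
    have : S = Set.range fun g : orthComm J =>
        P ((g : Matrix.orthogonalGroup (Fin n) ℝ) : Matrix (Fin n) (Fin n) ℝ) := by
      rw [horbit]
      ext Y
      constructor
      · rintro ⟨X, hX, rfl⟩
        exact ⟨⟨X, hX⟩, rfl⟩
      · rintro ⟨X, rfl⟩
        exact ⟨X.1, X.2, rfl⟩
    rw [this]
    exact isCompact_range hcoe
  refine ⟨hcomp, ?_⟩
  -- the orbit map and the quotient
  let f : orthComm J →
      {Y : Matrix.orthogonalGroup (Fin n) ℝ // (Y : Matrix (Fin n) (Fin n) ℝ) ∈ S} :=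
    fun g => ⟨⟨P g, (hS (hPS g g.2)).1⟩, hPS g g.2⟩
  have hf : Continuous f := (hcoe.subtype_mk _).subtype_mk _
  have hfs : Function.Surjective f := by
    rintro ⟨⟨Y, hYo⟩, hY⟩
    have hY' : Y ∈ S := hY
    rw [horbit] at hY'
    obtain ⟨X, hX, rfl⟩ := hY'
    exact ⟨⟨X, hX⟩, rfl⟩
  obtain ⟨e, he⟩ := exists_homeomorph_quotient ((orthComm Z).subgroupOf (orthComm J)) hf hfs
    fun a b => by
      rw [Subgroup.mem_subgroupOf, Subtype.ext_iff, Subtype.ext_iff]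
      exact orbit_stabilizer hC a.1 b.1
  -- the slices of the orbit
  let L : {Y : Matrix.orthogonalGroup (Fin n) ℝ // (Y : Matrix (Fin n) (Fin n) ℝ) ∈ S} →
      Submodule ℝ (Matrix (Fin n) (Fin n) ℝ) := fun Y =>
    skewSubmodule n ⊓ twistedCommutant (-1) (Y : Matrix (Fin n) (Fin n) ℝ)
  -- All points of the orbit are orthogonally conjugate to `Z`, so the slices have one common
  -- dimension, as a fixed model space requires.
  have hd : ∀ Y, Module.finrank ℝ (L Y) =
      Module.finrank ℝ ↥(skewSubmodule n ⊓ twistedCommutant (-1) Z) := fun Y => by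
    obtain ⟨g, rfl⟩ := hfs Y
    have hPg : P g = C * (g.1 : Matrix (Fin n) (Fin n) ℝ) * Z *
        (C * (g.1 : Matrix (Fin n) (Fin n) ℝ))ᵀ := by
      simp only [P, transpose_mul, mul_assoc]
    rw [← finrank_twistedCommutant_conj (mul_mem_orthogonalGroup hC g.1.2) (-1) Z, ← hPg]
  have hL : ∀ Y : {Y : Matrix.orthogonalGroup (Fin n) ℝ // (Y : Matrix (Fin n) (Fin n) ℝ) ∈ S},
      ∀ v : Matrix (Fin n) (Fin n) ℝ,
      IsUnit (1 + v * (Y : Matrix (Fin n) (Fin n) ℝ)ᵀ) → (v ∈ S ↔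
        cay (v * (Y : Matrix (Fin n) (Fin n) ℝ)ᵀ) ∈ L Y) := fun Y v h =>
    squareRoots_slice hS hchar Y.2 h
  let AS := cayleySliceAtlas (X := {Y : Matrix.orthogonalGroup (Fin n) ℝ //
      (Y : Matrix (Fin n) (Fin n) ℝ) ∈ S}) IsEmbedding.subtypeVal L hd fun Y v h => by
    rw [← hL Y v h]
    exact ⟨fun ⟨y, hy⟩ => hy ▸ y.2, fun hv => ⟨⟨⟨v, (hS hv).1⟩, hv⟩, rfl⟩⟩
  have hLQ : ∀ q : orthComm J ⧸ (orthComm Z).subgroupOf (orthComm J),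
      ∀ v : Matrix (Fin n) (Fin n) ℝ,
      IsUnit (1 + v * ((e q : Matrix.orthogonalGroup (Fin n) ℝ) : Matrix (Fin n) (Fin n) ℝ)ᵀ) →
      ((∃ y, ((e y : Matrix.orthogonalGroup (Fin n) ℝ) : Matrix (Fin n) (Fin n) ℝ) = v) ↔
        cay (v * ((e q : Matrix.orthogonalGroup (Fin n) ℝ) : Matrix (Fin n) (Fin n) ℝ)ᵀ) ∈
          L (e q)) := fun q v h => by
    rw [← hL (e q) v h]
    exact ⟨fun ⟨y, hy⟩ => hy ▸ (e y).2, fun hv =>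
      ⟨e.symm ⟨⟨v, (hS hv).1⟩, hv⟩, by rw [e.apply_symm_apply]⟩⟩
  have hιQ : IsEmbedding fun q => (e q : Matrix.orthogonalGroup (Fin n) ℝ) :=
    IsEmbedding.subtypeVal.comp e.isEmbedding
  -- The quotient is charted through its embedding `e`, which makes the diffeomorphism with the
  -- orbit automatic and leaves the submersion to prove.
  let AQ := cayleySliceAtlas hιQ (fun q => L (e q)) (fun q => hd (e q)) hLQ
  refine ⟨(orthogonalSliceAtlas n).smoothStructure, AS.smoothStructure,
    (orthCommSliceAtlas J).smoothStructure, AQ.smoothStructure,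
    (orthogonalSliceAtlas n).embedsInSpace, ?_, ?_, ?_, ?_⟩
  · exact cayleySliceAtlas_embedsIn _ _ _ _ _ _ _ _ (fun x => rfl) fun x => inf_le_left
  · exact cayleySliceAtlas_embedsIn _ _ _ _ _ _ _ _ (fun x => rfl) fun x => inf_le_left
  · refine SliceAtlas.submersesOnto (orthCommSliceAtlas J) AQ continuous_quotient_mk'
      Quotient.mk_surjective hP (fun g => ?_) fun g w => ?_
    · rw [he]
    · set W := AQ.i (g : _ ⧸ _) w with hW
      have hWL : W ∈ L (e (g : _ ⧸ _)) :=
        cayleySliceAtlas_i_mem hιQ (fun q => L (e q)) (fun q => hd (e q)) hLQ _ _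
      rw [he] at hWL
      have hWs : Wᵀ = -W := hWL.1
      have hYW : P g * W = -(W * P g) := mem_twistedCommutant_neg_one.mp hWL.2
      have hPg := hS (hPS g g.2)
      -- The direction lifting `W`; the factor `1/2` cancels the `2` in `hasDerivAt_orbit`.
      set X := (1 / 2 : ℝ) • (Cᵀ * W * C) with hX
      have hCC := mem_orthogonalGroup_iff_transpose_mul.mp hC
      have hCC' := mem_orthogonalGroup_iff_mul_transpose.mp hC
      -- Anticommuting with `P g`, `W` commutes with its square `C J Cᵀ`; hence `X` is tangent to
      -- the centralizer of `J`.
      have hJW : C * J * Cᵀ * W = W * (C * J * Cᵀ) := by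
        rw [← hPg.2, mul_assoc, hYW, mul_neg, ← mul_assoc, hYW, neg_mul, neg_neg, mul_assoc]
      have hXmem : X ∈ skewSubmodule n ⊓ twistedCommutant 1 J := by
        refine Submodule.smul_mem _ _ ⟨?_, mem_twistedCommutant_one.mpr ?_⟩
        · rw [SetLike.mem_coe, mem_skewSubmodule, transpose_mul, transpose_mul, transpose_transpose,
            hWs, neg_mul, mul_neg, mul_assoc]
        · calc J * (Cᵀ * W * C) = (Cᵀ * C) * J * Cᵀ * W * C := by
                rw [hCC, one_mul]; simp only [mul_assoc]
            _ = Cᵀ * (C * J * Cᵀ * W) * C := by simp only [mul_assoc]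
            _ = Cᵀ * W * C * J * (Cᵀ * C) := by rw [hJW]; simp only [mul_assoc]
            _ = _ := by rw [hCC, mul_one]
      have hXW : C * X * Cᵀ = (1 / 2 : ℝ) • W := by
        rw [hX, Matrix.mul_smul, Matrix.smul_mul]
        congr 1
        calc C * (Cᵀ * W * C) * Cᵀ = (C * Cᵀ) * W * (C * Cᵀ) := by simp only [mul_assoc]
          _ = W := by rw [hCC', one_mul, mul_one]
      have hder := hasDerivAt_orbit (Z := Z) (g := g) hC
        (mem_orthogonalGroup_iff_mul_transpose.mp hPg.1) rfl hXW
        (by rw [transpose_smul, hWs, smul_neg])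
        (by rw [Matrix.mul_smul, hYW, Matrix.smul_mul, smul_neg])
      rw [smul_smul, show (2 : ℝ) * (1 / 2) = 1 by norm_num, one_smul] at hder
      refine ⟨(orthCommSliceAtlas J).p g X, hder.congr_of_eventuallyEq
        (Filter.Eventually.of_forall fun t => ?_)⟩
      beta_reduce
      have h0 : (orthCommSliceAtlas J).chart g g = 0 := cayleySliceAtlas_chart_self _ _ _ _ _
      have h1 : (orthCommSliceAtlas J).i g ((orthCommSliceAtlas J).p g X) = X :=
        cayleySliceAtlas_i_p _ _ _ _ _ hXmem
      rw [h0, zero_add, map_smul, h1]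
      change cay (P (cay (t • X) * _) *
        ((e (g : _ ⧸ _) : Matrix.orthogonalGroup (Fin n) ℝ) : Matrix (Fin n) (Fin n) ℝ)ᵀ) = _
      rw [he]
  · exact SliceAtlas.diffeomorphic AS AQ e.symm fun x => by
      rw [e.apply_symm_apply]

end Geometry

end OrthRoots
end

/-! ### The proposition, assembled from the two halves. -/

theorem proposition4p2 {n r h k : ℕ} {m : Fin r → ℕ}
    (hn : h + ((∑ j, m j * 2) + k * 2) = n) (hm : ∀ j, 0 < m j)
    (θ : Fin r → ℝ) (hθ : StrictMono θ) (hθ0 : ∀ j, 0 < θ j) (hθπ : ∀ j, θ j < Real.pi)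
    (M C₀ : Matrix (Fin n) (Fin n) ℝ)
    (hM : M ∈ Matrix.specialOrthogonalGroup (Fin n) ℝ)
    (hC₀ : C₀ ∈ Matrix.orthogonalGroup (Fin n) ℝ)
    (hMC : M = C₀ * OrthRoots.rjs hn θ * C₀ᵀ)
    (u : ℕ) (hu : u ≤ h) (μ : Fin r → ℕ) (hμ : ∀ j, μ j ≤ m j) :
    -- the stratum is an orbit
    (OrthRoots.OSRStratum M h m k θ u μ =
      {Y | ∃ X ∈ OrthRoots.orthComm (OrthRoots.rjs hn θ),
        Y = C₀ * (X : Matrix (Fin n) (Fin n) ℝ) * OrthRoots.rja hn θ u μ *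
          (X : Matrix (Fin n) (Fin n) ℝ)ᵀ * C₀ᵀ}) ∧
    -- it is the congruence image of the stratum of the Jordan form, which is a block sum
    (OrthRoots.OSRStratum M h m k θ u μ =
      OrthRoots.congruence C₀ '' OrthRoots.OSRStratum (OrthRoots.rjs hn θ) h m k θ u μ) ∧
    (OrthRoots.OSRStratum (OrthRoots.rjs hn θ) h m k θ u μ = OrthRoots.modelSet hn θ u μ) ∧
    -- it is a compact submanifold of the orthogonal group, diffeomorphic to the homogeneous space
    IsCompact (OrthRoots.OSRStratum M h m k θ u μ) ∧
    (OrthRoots.orthComm (OrthRoots.rja hn θ u μ) ≤ OrthRoots.orthComm (OrthRoots.rjs hn θ)) ∧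
    ∃ (𝒪 : OrthRoots.SmoothStructure (Matrix.orthogonalGroup (Fin n) ℝ))
      (𝒮 : OrthRoots.SmoothStructure
        {Y : Matrix.orthogonalGroup (Fin n) ℝ // (Y : Matrix (Fin n) (Fin n) ℝ) ∈
          OrthRoots.OSRStratum M h m k θ u μ})
      (𝒢 : OrthRoots.SmoothStructure (OrthRoots.orthComm (OrthRoots.rjs hn θ)))
      (𝒬 : OrthRoots.SmoothStructure (OrthRoots.orthComm (OrthRoots.rjs hn θ) ⧸
        (OrthRoots.orthComm (OrthRoots.rja hn θ u μ)).subgroupOf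
          (OrthRoots.orthComm (OrthRoots.rjs hn θ)))),
      𝒪.EmbedsInSpace (Subtype.val : _ → Matrix (Fin n) (Fin n) ℝ) ∧
      𝒮.EmbedsIn 𝒪 Subtype.val ∧
      𝒢.EmbedsIn 𝒪 Subtype.val ∧
      𝒢.SubmersesOnto 𝒬 QuotientGroup.mk ∧
      𝒮.Diffeomorphic 𝒬 := by
  subst hMC
  have horbit := OrthRoots.OSRStratum_eq_orbit hn hθ hθ0 hθπ hC₀ hu hμ
  obtain ⟨hcomp, hgeom⟩ := OrthRoots.exists_smoothStructures
    (S := OrthRoots.OSRStratum (C₀ * OrthRoots.rjs hn θ * C₀ᵀ) h m k θ u μ) hC₀ (fun Y hY => hY.1)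
    -- The stratum is cut out of the square roots by root multiplicities, which depend on the
    -- characteristic polynomial alone.
    (fun Y hY v hv hc => ⟨hv, by
      have h1 : OrthRoots.eigMult v = OrthRoots.eigMult Y := by
        funext z
        rw [OrthRoots.eigMult, OrthRoots.eigMult, charpoly_map, charpoly_map, hc]
      rw [h1]
      exact hY.2⟩) horbit
  exact ⟨horbit, OrthRoots.OSRStratum_eq_image θ hC₀,
    OrthRoots.OSRStratum_eq_modelSet hn hθ hθ0 hθπ, hcomp,
    OrthRoots.orthComm_rja_le hn hθ hθ0 hθπ hu hμ, hgeom⟩
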